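/- (Rellich theorem in hyperbolic space.) Let $n\ge 1$ and let $\mathbb{B}^n=\{x\in\mathbb{R}^n:|x|<1\}$ be the Poincaré ball model of hyperbolic space, with metric $\left(\frac{2}{1-|x|^2}\right)^2|dx|^2$. Write $\rho(x)=\log\frac{1+|x|}{1-|x|}$ for the hyperbolic distance from the origin to $x$, $$\Delta_{\mathbb{H}}=\frac{1-|x|^2}{4}\Big((1-|x|^2)\Delta_{\mathbb{R}^n}+2(n-2)\sum_{i=1}^n x_i\frac{\partial}{\partial x_i}\Big)$$ for the Laplace–Beltrami operator, $B_{\mathbb{H}}(0,R)=\{x\in\mathbb{B}^n:\rho(x)<R\}$, and $d\sigma_{\mathbb{H}}=\left(\frac{2}{1-|x|^2}\right)^{n-1}d\sigma$ for the hyperbolic surface measure on $\partial B_{\mathbb{H}}(0,R)=\{|x|=\tanh\frac R2\}$, where $d\sigma$ is the Euclidean surface measure of this sphere (counting measure if $n=1$). Let $\mu\in\mathbb{R}$ and $R_0>0$, and let $u$ be a complex-valued function that is of class $C^2$ on the exterior $\{x\in\mathbb{B}^n:\rho(x)>R_0\}$ and satisfies there the homogeneous Helmholtz equation $$-\Delta_{\mathbb{H}}u-\frac{(n-1)^2}{4}u-\mu^2u=0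 .$$ If $$\lim_{R\to+\infty}\int_{\partial B_{\mathbb{H}}(0,R)}|u|^2\,d\sigma_{\mathbb{H}}=0,$$ then $u(x)=0$ for every $x\in\mathbb{B}^n$ with $\rho(x)>R_0$. If moreover $u$ is defined and continuous on $\mathbb{B}^n\setminus B_{\mathbb{H}}(0,R_0)=\{x\in\mathbb{B}^n:\rho(x)\ge R_0\}$ (in particular, if $u\in C^2(\mathbb{B}^n\setminus B_{\mathbb{H}}(0,R_0))$), then $u=0$ on all of $\mathbb{B}^n\setminus B_{\mathbb{H}}(0,R_0)$. -/

import Mathlib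

open scoped Topology

/-- The Poincaré ball `𝔹ⁿ`, as a set: the open Euclidean unit ball of `ℝⁿ`. -/
def poincareBall (n : ℕ) : Set (EuclideanSpace ℝ (Fin n)) :=
  {x | ‖x‖ < 1}

/-- The hyperbolic distance `ρ(x) = log ((1 + |x|) / (1 - |x|))` from the origin to a point `x` of
the Poincaré ball. -/
noncomputable def hypRho {n : ℕ} (x : EuclideanSpace ℝ (Fin n)) : ℝ :=
  Real.log ((1 + ‖x‖) / (1 - ‖x‖))

/-- The open hyperbolic ball `B_ℍ(0, R)`. -/
def hypBall (n : ℕ) (R : ℝ) : Set (EuclideanSpace ℝ (Fin n)) :=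
  {x | x ∈ poincareBall n ∧ hypRho x < R}

/-- The closed hyperbolic ball of radius `R` centred at the origin. -/
def hypClosedBall (n : ℕ) (R : ℝ) : Set (EuclideanSpace ℝ (Fin n)) :=
  {x | x ∈ poincareBall n ∧ hypRho x ≤ R}

/-- The Laplace–Beltrami operator of the metric `(2 / (1 - |x|²))² |dx|²` on the Poincaré ball:
`Δ_ℍ = (1 - |x|²)/4 · ((1 - |x|²) Δ + 2 (n - 2) ∑ i, xᵢ ∂ᵢ)`. -/
noncomputable def hypLaplacian {n : ℕ} (u : EuclideanSpace ℝ (Fin n) → ℂ)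
    (x : EuclideanSpace ℝ (Fin n)) : ℂ :=
  ((1 - ‖x‖ ^ 2) / 4 : ℝ) •
    ((1 - ‖x‖ ^ 2 : ℝ) • Laplacian.laplacian u x +
      (2 * ((n : ℝ) - 2)) •
        ∑ i, x i • fderiv ℝ u x (EuclideanSpace.single i (1 : ℝ)))

/-- The Euclidean surface measure `dσ` of the sphere `∂Bⁿ(0, r)`, `r > 0`, as a measure on `ℝⁿ`:
the surface measure of the unit sphere, transported by `ω ↦ r ω` and multiplied by `rⁿ⁻¹`. -/
noncomputable def euclSphereMeasure (n : ℕ) (r : ℝ) :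
    MeasureTheory.Measure (EuclideanSpace ℝ (Fin n)) :=
  ENNReal.ofReal (r ^ (n - 1)) •
    MeasureTheory.Measure.map
      (fun ω : Metric.sphere (0 : EuclideanSpace ℝ (Fin n)) 1 =>
        r • (ω : EuclideanSpace ℝ (Fin n)))
      (MeasureTheory.volume : MeasureTheory.Measure (EuclideanSpace ℝ (Fin n))).toSphere

/-- The hyperbolic surface measure `dσ_ℍ` of `∂B_ℍ(0, R)`, `R > 0`. As a set, `∂B_ℍ(0, R)` is the
Euclidean sphere of radius `tanh (R / 2)`, and `dσ_ℍ = (2 / (1 - |x|²))ⁿ⁻¹ dσ` there. -/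
noncomputable def hypSphereMeasure (n : ℕ) (R : ℝ) :
    MeasureTheory.Measure (EuclideanSpace ℝ (Fin n)) :=
  (euclSphereMeasure n (Real.tanh (R / 2))).withDensity
    fun x => ENNReal.ofReal ((2 / (1 - ‖x‖ ^ 2)) ^ (n - 1))

/-! ### Rotation invariance of the surface measure of the unit sphere. -/

section SphereMeasure

open MeasureTheory Set
open scoped Pointwise

/-! Separation of variables, tested against polynomials instead of spherical harmonics. For a
homogeneous polynomial P of degree d, let b(s) be the integral over the unit sphere of u(tanh(s/2)
ω) P(ω) (`sphCoeff`). The spherical Laplacian is half the sum of the squares of the infinitesimal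
rotations, and rotations preserve surface measure, so it is self-adjoint
(`integral_toSphere_sphericalLaplacian`). On the sphere it sends P to ΔP - d(d+n-2)P. Strong
induction on d makes the coefficient of ΔP vanish, so b satisfies a radial ODE and no decomposition
into harmonics is needed (`sphCoeff_radial_equation`).

The substitution w = (sinh s)^((n-1)/2) b removes the first-order term and gives w'' = (q - μ²) w
with q a constant multiple of 1/sinh². The shift (n-1)²/4 in the equation is exactly what cancels
the constant part of the potential. The square of the weight is the density of the hyperbolic sphere
measure, so Cauchy-Schwarz turns the hypothesis on u into w → 0.

Since q decays exponentially, w is a small perturbation of a solution of w'' = -μ² w, and only the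
zero solution tends to 0. Factoring the operator into two first-order ones and integrating from
infinity shows that any bound on w near infinity can be halved. Thus w vanishes near infinity, and
everywhere by ODE uniqueness (`eq_zero_of_ode_of_tendsto_zero`). This is uniform in real μ, zero
included.

All coefficients of u therefore vanish, and Stone-Weierstrass gives u = 0 on every sphere of radius
s > R₀ (`eq_zero_of_integral_toSphere_mul_polyFun`). The boundary values follow by continuity along
rays. -/

/-- Differentiation under the integral sign over a compact space of finite measure. -/
theorem hasDerivAt_integral_of_continuousOn_compact {Ω : Type*} [TopologicalSpace Ω]
    [CompactSpace Ω] [MeasurableSpace Ω] [BorelSpace Ω] [SecondCountableTopology Ω]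
    (σ : Measure Ω) [IsFiniteMeasure σ] {s : Set ℝ} (hs : IsOpen s) {F F' : ℝ → Ω → ℂ}
    (hF : ∀ t ∈ s, Continuous (F t))
    (hF' : ContinuousOn (Function.uncurry F') (s ×ˢ univ))
    (hd : ∀ t ∈ s, ∀ ω, HasDerivAt (fun t => F t ω) (F' t ω) t) {t₀ : ℝ} (ht₀ : t₀ ∈ s) :
    HasDerivAt (fun t => ∫ ω, F t ω ∂σ) (∫ ω, F' t₀ ω ∂σ) t₀ := by
  obtain ⟨ε, hε, hsub⟩ := Metric.nhds_basis_closedBall.mem_iff.1 (hs.mem_nhds ht₀)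
  have hK : IsCompact (Metric.closedBall t₀ ε ×ˢ (univ : Set Ω)) :=
    (isCompact_closedBall t₀ ε).prod isCompact_univ
  obtain ⟨C, hC⟩ := hK.exists_bound_of_continuousOn
    (hF'.mono (prod_mono hsub Subset.rfl))
  have hslice : ∀ t ∈ s, Continuous (F' t) := fun t ht =>
    continuousOn_univ.1 <| hF'.comp (f := fun ω => (t, ω))
      (by fun_prop) (fun ω _ => ⟨ht, mem_univ _⟩)
  refine (hasDerivAt_integral_of_dominated_loc_of_deriv_le (bound := fun _ => C)
    (Metric.closedBall_mem_nhds t₀ hε) ?_ ?_ ?_ ?_ ?_ ?_).2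
  · filter_upwards [hs.mem_nhds ht₀] with t ht
    exact (hF t ht).aestronglyMeasurable
  · exact (hF t₀ ht₀).integrable_of_hasCompactSupport (HasCompactSupport.of_compactSpace _)
  · exact (hslice t₀ ht₀).aestronglyMeasurable
  · exact .of_forall fun ω t ht => hC (t, ω) ⟨ht, mem_univ _⟩
  · exact integrable_const _
  · exact .of_forall fun ω t ht => hd t (hsub ht) ω

variable {E : Type*} [NormedAddCommGroup E] [InnerProductSpace ℝ E] [FiniteDimensional ℝ E]
  [MeasurableSpace E] [BorelSpace E]

/-- The homeomorphism of the unit sphere induced by a linear isometry. -/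
def LinearIsometryEquiv.sphereHomeomorph (e : E ≃ₗᵢ[ℝ] E) :
    Metric.sphere (0 : E) 1 ≃ₜ Metric.sphere (0 : E) 1 :=
  e.toHomeomorph.subtype fun x => by simp

/-- The sphere measure of a set is, up to a dimensional factor, the volume of the cone over it. A
linear isometry carries cones to cones and preserves volume. -/
theorem LinearIsometryEquiv.measurePreserving_sphere (e : E ≃ₗᵢ[ℝ] E) :
    MeasurePreserving e.sphereHomeomorph (volume : Measure E).toSphere
      (volume : Measure E).toSphere := by
  refine ⟨e.sphereHomeomorph.measurable, ?_⟩
  ext s hs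
  rw [Measure.map_apply e.sphereHomeomorph.measurable hs,
    Measure.toSphere_apply' _ (e.sphereHomeomorph.measurable hs), Measure.toSphere_apply' _ hs]
  congr 1
  rw [← e.measurePreserving.measure_preimage_equiv (f := e.toMeasurableEquiv)
    (Ioo (0 : ℝ) 1 • (Subtype.val '' s))]
  congr 1
  ext x
  simp only [mem_smul, mem_image, mem_preimage]
  constructor
  · rintro ⟨r, hr, _, ⟨ω, hω, rfl⟩, rfl⟩
    exact ⟨r, hr, _, ⟨_, hω, rfl⟩, (e.map_smul r _).symm⟩
  · rintro ⟨r, hr, _, ⟨ω, hω, rfl⟩, h⟩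
    refine ⟨r, hr, _, ⟨e.sphereHomeomorph.symm ω, by simpa using hω, rfl⟩, ?_⟩
    apply e.injective
    rw [e.map_smul]
    refine Eq.trans ?_ h
    congr 1
    exact congrArg Subtype.val (e.sphereHomeomorph.apply_symm_apply ω)

theorem integral_toSphere_comp_linearIsometryEquiv (e : E ≃ₗᵢ[ℝ] E) (f : E → ℂ) :
    ∫ ω : Metric.sphere (0 : E) 1, f (e ω) ∂(volume : Measure E).toSphere =
      ∫ ω : Metric.sphere (0 : E) 1, f ω ∂(volume : Measure E).toSphere :=
  e.measurePreserving_sphere.integral_comp e.sphereHomeomorph.measurableEmbedding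
    (fun ω : Metric.sphere (0 : E) 1 => f ω)

/-- The derivative of a `C¹` function along an infinitesimal rotation has zero mean over the unit
sphere. -/
theorem integral_toSphere_fderiv_skew (J : E →L[ℝ] E) (hJ : J ∈ skewAdjoint (E →L[ℝ] E))
    {U : Set E} (hU : IsOpen U) (hSU : Metric.sphere (0 : E) 1 ⊆ U) {h : E → ℂ}
    (hh : ContDiffOn ℝ 1 h U) :
    ∫ ω : Metric.sphere (0 : E) 1, fderiv ℝ h ω (J ω) ∂(volume : Measure E).toSphere = 0 := by
  let : NormedAlgebra ℚ (E →L[ℝ] E) := NormedAlgebra.restrictScalars ℚ ℝ _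
  have hskew : ∀ t : ℝ, t • J ∈ skewAdjoint (E →L[ℝ] E) := fun t => skewAdjoint.smul_mem t hJ
  have hunit : ∀ t : ℝ, NormedSpace.exp (t • J) ∈ unitary (E →L[ℝ] E) := fun t =>
    NormedSpace.exp_mem_unitary_of_mem_skewAdjoint (hskew t)
  -- The exponential of a skew-adjoint operator is unitary, so J generates a one-parameter group of
  -- isometries. The mean of h along this flow is constant in t, and the claim is its derivative at
  -- t = 0.
  let e : ℝ → (E ≃ₗᵢ[ℝ] E) := fun t => Unitary.linearIsometryEquiv ⟨_, hunit t⟩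
  have he : ∀ t x, e t x = NormedSpace.exp (t • J) x := fun t x => rfl
  have hexp : ∀ t : ℝ, HasDerivAt (fun t : ℝ => NormedSpace.exp (t • J))
      (J * NormedSpace.exp (t • J)) t := fun t => hasDerivAt_exp_smul_const' J t
  have hexpc : Continuous (fun t : ℝ => NormedSpace.exp (t • J)) :=
    continuous_iff_continuousAt.2 fun t => (hexp t).continuousAt
  have hmem : ∀ t (ω : Metric.sphere (0 : E) 1), NormedSpace.exp (t • J) (ω : E) ∈ U :=
    fun t ω => hSU (by rw [← he]; simp)
  have hjoint : Continuous fun p : ℝ × Metric.sphere (0 : E) 1 =>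
      NormedSpace.exp (p.1 • J) (p.2 : E) :=
    (hexpc.comp continuous_fst).clm_apply (by fun_prop)
  have hfd : ContinuousOn (fderiv ℝ h) U := hh.continuousOn_fderiv_of_isOpen hU le_rfl
  have key := hasDerivAt_integral_of_continuousOn_compact (volume : Measure E).toSphere
    (s := univ) isOpen_univ
    (F := fun t (ω : Metric.sphere (0 : E) 1) => h (NormedSpace.exp (t • J) (ω : E)))
    (F' := fun t (ω : Metric.sphere (0 : E) 1) =>
      fderiv ℝ h (NormedSpace.exp (t • J) (ω : E)) (J (NormedSpace.exp (t • J) (ω : E))))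
    (fun t _ => hh.continuousOn.comp_continuous (by fun_prop) (hmem t))
    (by
      refine Continuous.continuousOn ?_
      exact (hfd.comp_continuous hjoint (fun p => hmem p.1 p.2)).clm_apply
        (J.continuous.comp hjoint))
    (fun t _ ω => by
      have h1 : HasDerivAt (fun t : ℝ => NormedSpace.exp (t • J) (ω : E))
          ((J * NormedSpace.exp (t • J)) (ω : E)) t := by
        simpa using (hexp t).clm_apply (hasDerivAt_const t (ω : E))
      have h2 : HasFDerivAt h (fderiv ℝ h (NormedSpace.exp (t • J) (ω : E)))
          (NormedSpace.exp (t • J) (ω : E)) :=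
        ((hh.differentiableOn one_ne_zero).differentiableAt
          (hU.mem_nhds (hmem t ω))).hasFDerivAt
      exact h2.comp_hasDerivAt t h1)
    (mem_univ 0)
  have hconst : (fun t : ℝ => ∫ ω : Metric.sphere (0 : E) 1,
      h (NormedSpace.exp (t • J) (ω : E)) ∂(volume : Measure E).toSphere) =
      fun _ => ∫ ω : Metric.sphere (0 : E) 1, h ω ∂(volume : Measure E).toSphere := by
    funext t
    exact integral_toSphere_comp_linearIsometryEquiv (e t) h
  rw [hconst] at key
  simpa using key.unique (hasDerivAt_const _ _)

end SphereMeasure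

/-! ### The spherical Laplacian as a sum of squares of rotation generators. -/

section Rotations

open MeasureTheory Set

section General

variable {E : Type*} [NormedAddCommGroup E] [InnerProductSpace ℝ E]

theorem hasFDerivAt_fderiv_apply_clm (J : E →L[ℝ] E) {U : Set E} (hU : IsOpen U) {v : E → ℂ}
    (hv : ContDiffOn ℝ 2 v U) {x : E} (hx : x ∈ U) :
    HasFDerivAt (fun y => fderiv ℝ v y (J y))
      ((fderiv ℝ v x).comp J + (fderiv ℝ (fderiv ℝ v) x).flip (J x)) x := by
  have h1 : HasFDerivAt (fderiv ℝ v) (fderiv ℝ (fderiv ℝ v) x) x :=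
    (((hv.fderiv_of_isOpen hU (m := 1) (by norm_num)).differentiableOn
      one_ne_zero).differentiableAt (hU.mem_nhds hx)).hasFDerivAt
  exact h1.clm_apply J.hasFDerivAt

theorem contDiffOn_fderiv_apply_clm (J : E →L[ℝ] E) {U : Set E} (hU : IsOpen U) {v : E → ℂ}
    (hv : ContDiffOn ℝ 2 v U) : ContDiffOn ℝ 1 (fun y => fderiv ℝ v y (J y)) U :=
  (hv.fderiv_of_isOpen hU (m := 1) (by norm_num)).clm_apply J.contDiff.contDiffOn

variable [FiniteDimensional ℝ E] [MeasurableSpace E] [BorelSpace E]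

theorem integrable_toSphere_of_continuousOn {f : E → ℂ} {U : Set E}
    (hSU : Metric.sphere (0 : E) 1 ⊆ U) (hf : ContinuousOn f U) :
    Integrable (fun ω : Metric.sphere (0 : E) 1 => f ω) (volume : Measure E).toSphere :=
  (hf.comp_continuous continuous_subtype_val fun ω => hSU ω.2).integrable_of_hasCompactSupport
    (HasCompactSupport.of_compactSpace _)

/-- Integration by parts on the unit sphere for an infinitesimal rotation. -/
theorem integral_toSphere_fderiv_skew_mul (J : E →L[ℝ] E) (hJ : J ∈ skewAdjoint (E →L[ℝ] E))
    {U : Set E} (hU : IsOpen U) (hSU : Metric.sphere (0 : E) 1 ⊆ U) {f g : E → ℂ}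
    (hf : ContDiffOn ℝ 1 f U) (hg : ContDiffOn ℝ 1 g U) :
    ∫ ω : Metric.sphere (0 : E) 1, fderiv ℝ f ω (J ω) * g ω ∂(volume : Measure E).toSphere =
      -∫ ω : Metric.sphere (0 : E) 1, f ω * fderiv ℝ g ω (J ω) ∂(volume : Measure E).toSphere := by
  -- The product rule applied to the zero-mean identity for f * g.
  have h := integral_toSphere_fderiv_skew J hJ hU hSU (hf.mul hg)
  have hpt : ∀ ω : Metric.sphere (0 : E) 1, fderiv ℝ (f * g) ω (J ω) =
      fderiv ℝ f ω (J ω) * g ω + f ω * fderiv ℝ g ω (J ω) := by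
    intro ω
    have hn := hU.mem_nhds (hSU ω.2)
    rw [fderiv_mul ((hf.differentiableOn one_ne_zero).differentiableAt hn)
      ((hg.differentiableOn one_ne_zero).differentiableAt hn)]
    simp only [_root_.add_apply, _root_.smul_apply, smul_eq_mul]
    ring
  have hi : ∀ {f g : E → ℂ}, ContDiffOn ℝ 1 f U → ContDiffOn ℝ 1 g U →
      ContinuousOn (fun x => fderiv ℝ f x (J x) * g x) U := fun hf hg =>
    ((hf.continuousOn_fderiv_of_isOpen hU le_rfl).clm_apply J.continuous.continuousOn).mul
      hg.continuousOn
  have h : ∫ ω : Metric.sphere (0 : E) 1, (fderiv ℝ f ω (J ω) * g ω + f ω * fderiv ℝ g ω (J ω))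
      ∂(volume : Measure E).toSphere = 0 := (integral_congr_ae (.of_forall hpt)).symm.trans h
  rw [integral_add (integrable_toSphere_of_continuousOn hSU (hi hf hg))
    (integrable_toSphere_of_continuousOn (f := fun x => f x * fderiv ℝ g x (J x)) hSU
      (by simpa only [mul_comm] using hi hg hf))] at h
  exact eq_neg_of_add_eq_zero_left h

/-- The bracket is the derivative along the field x ↦ J x, taken twice. Two integrations by parts
move it to the other factor, and their signs cancel. -/
theorem integral_toSphere_second_deriv_skew (J : E →L[ℝ] E) (hJ : J ∈ skewAdjoint (E →L[ℝ] E))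
    {U : Set E} (hU : IsOpen U) (hSU : Metric.sphere (0 : E) 1 ⊆ U) {v p : E → ℂ}
    (hv : ContDiffOn ℝ 2 v U) (hp : ContDiffOn ℝ 2 p U) :
    ∫ ω : Metric.sphere (0 : E) 1, (fderiv ℝ v ω (J (J ω)) +
        fderiv ℝ (fderiv ℝ v) ω (J ω) (J ω)) * p ω ∂(volume : Measure E).toSphere =
      ∫ ω : Metric.sphere (0 : E) 1, v ω * (fderiv ℝ p ω (J (J ω)) +
        fderiv ℝ (fderiv ℝ p) ω (J ω) (J ω)) ∂(volume : Measure E).toSphere := by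
  have hsecond : ∀ {v : E → ℂ}, ContDiffOn ℝ 2 v U → ∀ ω : Metric.sphere (0 : E) 1,
      fderiv ℝ (fun y => fderiv ℝ v y (J y)) ω (J ω) =
        fderiv ℝ v ω (J (J ω)) + fderiv ℝ (fderiv ℝ v) ω (J ω) (J ω) := fun hv ω => by
    rw [(hasFDerivAt_fderiv_apply_clm J hU hv (hSU ω.2)).fderiv]
    rfl
  simp only [← hsecond hv, ← hsecond hp]
  rw [integral_toSphere_fderiv_skew_mul J hJ hU hSU (contDiffOn_fderiv_apply_clm J hU hv)
    (hp.of_le one_le_two)]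
  have := integral_toSphere_fderiv_skew_mul J hJ hU hSU (hv.of_le one_le_two)
    (contDiffOn_fderiv_apply_clm J hU hp)
  rw [this, neg_neg]

end General

variable {n : ℕ}

/-- The generator of the rotations in the coordinate plane spanned by `eᵢ` and `eⱼ`. -/
noncomputable def rotGen (i j : Fin n) :
    EuclideanSpace ℝ (Fin n) →L[ℝ] EuclideanSpace ℝ (Fin n) :=
  (EuclideanSpace.proj i).smulRight (EuclideanSpace.single j (1 : ℝ)) -
    (EuclideanSpace.proj j).smulRight (EuclideanSpace.single i (1 : ℝ))

theorem rotGen_apply (i j : Fin n) (x : EuclideanSpace ℝ (Fin n)) :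
    rotGen i j x = x i • EuclideanSpace.single j (1 : ℝ) -
      x j • EuclideanSpace.single i (1 : ℝ) := by
  simp [rotGen]

theorem rotGen_mem_skewAdjoint (i j : Fin n) : rotGen i j ∈
    skewAdjoint (EuclideanSpace ℝ (Fin n) →L[ℝ] EuclideanSpace ℝ (Fin n)) := by
  rw [skewAdjoint.mem_iff, ContinuousLinearMap.star_eq_adjoint, eq_comm,
    ContinuousLinearMap.eq_adjoint_iff]
  intro x y
  simp only [_root_.neg_apply, rotGen_apply, inner_neg_left, inner_sub_left,
    inner_sub_right, real_inner_smul_left, real_inner_smul_right,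
    EuclideanSpace.inner_single_left, EuclideanSpace.inner_single_right]
  simp
  ring

theorem euclidean_sum_coord_smul_single (x : EuclideanSpace ℝ (Fin n)) :
    ∑ i, x i • EuclideanSpace.single i (1 : ℝ) = x := by
  simpa using (EuclideanSpace.basisFun (Fin n) ℝ).sum_repr x

/-- For i ≠ j the square of the generator is minus the projection onto the (i, j) plane, and each
coordinate lies in 2(n - 1) ordered pairs. -/
theorem sum_rotGen_rotGen (x : EuclideanSpace ℝ (Fin n)) :
    ∑ i, ∑ j, rotGen i j (rotGen i j x) = -(2 * ((n : ℝ) - 1)) • x := by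
  have h : ∀ i j, rotGen i j (rotGen i j x) =
      (if i = j then x i else 0) • EuclideanSpace.single j (1 : ℝ)
        - x i • EuclideanSpace.single i (1 : ℝ) - x j • EuclideanSpace.single j (1 : ℝ)
        + (if i = j then x j else 0) • EuclideanSpace.single i (1 : ℝ) := by
    intro i j
    simp only [rotGen_apply, PiLp.sub_apply, PiLp.smul_apply, PiLp.single_apply, smul_eq_mul]
    by_cases hij : i = j
    · subst hij
      simp
    · simp [hij, Ne.symm hij]
      abel
  simp only [h, Finset.sum_add_distrib, Finset.sum_sub_distrib, ite_smul, zero_smul,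
    Finset.sum_ite_eq, Finset.mem_univ, if_true, euclidean_sum_coord_smul_single,
    Finset.sum_const, Finset.card_univ, Fintype.card_fin, ← Finset.smul_sum]
  simp only [← Nat.cast_smul_eq_nsmul ℝ]
  module

/-- The sum of the squares of the generators of the rotations, applied to a function with gradient
`A` and Hessian `B`. -/
theorem sum_rotGen_second_order (x : EuclideanSpace ℝ (Fin n))
    (A : EuclideanSpace ℝ (Fin n) →L[ℝ] ℂ)
    (B : EuclideanSpace ℝ (Fin n) →L[ℝ] EuclideanSpace ℝ (Fin n) →L[ℝ] ℂ) :
    ∑ i, ∑ j, (A (rotGen i j (rotGen i j x)) + B (rotGen i j x) (rotGen i j x)) =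
      2 * ((‖x‖ ^ 2 : ℝ) * ∑ k, B (EuclideanSpace.single k 1) (EuclideanSpace.single k 1)
        - B x x - ((n : ℂ) - 1) * A x) := by
  have hB : ∑ i, ∑ j, B (rotGen i j x) (rotGen i j x) =
      2 * ((‖x‖ ^ 2 : ℝ) * ∑ k, B (EuclideanSpace.single k 1) (EuclideanSpace.single k 1)
        - B x x) := by
    have hxx' : B x x = ∑ i, ∑ j, (x i : ℂ) * (x j : ℂ) *
        B (EuclideanSpace.single j 1) (EuclideanSpace.single i 1) := by
      conv_lhs => rw [← euclidean_sum_coord_smul_single x]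
      simp only [map_sum, map_smul, _root_.sum_apply, _root_.smul_apply,
        Complex.real_smul, Finset.mul_sum, mul_assoc]
    -- B need not be symmetric: the mixed terms occur in both orders, and each order sums to `B x
    -- x`.
    have hxx : B x x = ∑ i, ∑ j, (x i : ℂ) * (x j : ℂ) *
        B (EuclideanSpace.single i 1) (EuclideanSpace.single j 1) := by
      rw [hxx', Finset.sum_comm]
      exact Finset.sum_congr rfl fun i _ => Finset.sum_congr rfl fun j _ => by ring
    have hn : ((‖x‖ ^ 2 : ℝ) : ℂ) = ∑ i, (x i : ℂ) * (x i : ℂ) := by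
      rw [EuclideanSpace.real_norm_sq_eq]
      push_cast
      exact Finset.sum_congr rfl fun i _ => by ring
    have h : ∀ i j, B (rotGen i j x) (rotGen i j x) =
        (x i : ℂ) * (x i : ℂ) * B (EuclideanSpace.single j 1) (EuclideanSpace.single j 1)
        + (x j : ℂ) * (x j : ℂ) * B (EuclideanSpace.single i 1) (EuclideanSpace.single i 1)
        - (x i : ℂ) * (x j : ℂ) * B (EuclideanSpace.single i 1) (EuclideanSpace.single j 1)
        - (x i : ℂ) * (x j : ℂ) * B (EuclideanSpace.single j 1) (EuclideanSpace.single i 1) := by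
      intro i j
      simp only [rotGen_apply, map_sub, map_smul, _root_.sub_apply,
        _root_.smul_apply, Complex.real_smul]
      ring
    simp only [h, Finset.sum_add_distrib, Finset.sum_sub_distrib, ← hxx, ← hxx']
    simp only [← Finset.mul_sum, ← Finset.sum_mul, ← hn]
    ring
  simp only [Finset.sum_add_distrib]
  rw [hB]
  simp only [← map_sum]
  rw [sum_rotGen_rotGen, map_smul, Complex.real_smul]
  push_cast
  ring

/-- Self-adjointness of the spherical Laplacian, written in terms of Euclidean derivatives. -/
theorem integral_toSphere_sphericalLaplacian {U : Set (EuclideanSpace ℝ (Fin n))} (hU : IsOpen U)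
    (hSU : Metric.sphere (0 : EuclideanSpace ℝ (Fin n)) 1 ⊆ U)
    {v p : EuclideanSpace ℝ (Fin n) → ℂ} (hv : ContDiffOn ℝ 2 v U) (hp : ContDiffOn ℝ 2 p U) :
    ∫ ω : Metric.sphere (0 : EuclideanSpace ℝ (Fin n)) 1,
        (∑ k, fderiv ℝ (fderiv ℝ v) ω (EuclideanSpace.single k 1) (EuclideanSpace.single k 1)
          - fderiv ℝ (fderiv ℝ v) ω ω ω - ((n : ℂ) - 1) * fderiv ℝ v ω ω) * p ω
        ∂(volume : Measure (EuclideanSpace ℝ (Fin n))).toSphere =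
      ∫ ω : Metric.sphere (0 : EuclideanSpace ℝ (Fin n)) 1, v ω *
        (∑ k, fderiv ℝ (fderiv ℝ p) ω (EuclideanSpace.single k 1) (EuclideanSpace.single k 1)
          - fderiv ℝ (fderiv ℝ p) ω ω ω - ((n : ℂ) - 1) * fderiv ℝ p ω ω)
        ∂(volume : Measure (EuclideanSpace ℝ (Fin n))).toSphere := by
  have hc : ∀ {w : EuclideanSpace ℝ (Fin n) → ℂ}, ContDiffOn ℝ 2 w U → ∀ i j : Fin n,
      ContinuousOn (fun x => fderiv ℝ w x (rotGen i j (rotGen i j x)) +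
        fderiv ℝ (fderiv ℝ w) x (rotGen i j x) (rotGen i j x)) U := fun {w} hw i j => by
    have h1 : ContinuousOn (fderiv ℝ w) U := hw.continuousOn_fderiv_of_isOpen hU (by norm_num)
    have h2 : ContinuousOn (fderiv ℝ (fderiv ℝ w)) U :=
      (hw.fderiv_of_isOpen hU (m := 1) (by norm_num)).continuousOn_fderiv_of_isOpen hU le_rfl
    have hJ : ContinuousOn (fun x => rotGen i j x) U := (rotGen i j).continuous.continuousOn
    have hJJ : ContinuousOn (fun x => rotGen i j (rotGen i j x)) U :=
      ((rotGen i j).continuous.comp (rotGen i j).continuous).continuousOn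
    exact (h1.clm_apply hJJ).add ((h2.clm_apply hJ).clm_apply hJ)
  -- The factor 1/2 appears because the sum runs over ordered pairs; the norm of ω is 1.
  have hop : ∀ (w : EuclideanSpace ℝ (Fin n) → ℂ)
      (ω : Metric.sphere (0 : EuclideanSpace ℝ (Fin n)) 1),
      (∑ k, fderiv ℝ (fderiv ℝ w) ω (EuclideanSpace.single k 1) (EuclideanSpace.single k 1)
          - fderiv ℝ (fderiv ℝ w) ω ω ω - ((n : ℂ) - 1) * fderiv ℝ w ω ω) =
      2⁻¹ * ∑ i, ∑ j, (fderiv ℝ w ω (rotGen i j (rotGen i j (ω : EuclideanSpace ℝ (Fin n)))) +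
        fderiv ℝ (fderiv ℝ w) ω (rotGen i j (ω : EuclideanSpace ℝ (Fin n)))
          (rotGen i j (ω : EuclideanSpace ℝ (Fin n)))) := by
    intro w ω
    rw [sum_rotGen_second_order]
    simp
  simp only [hop]
  have e1 : ∀ a b : ℂ, 2⁻¹ * a * b = 2⁻¹ * (a * b) := fun a b => by ring
  have e2 : ∀ a b : ℂ, b * (2⁻¹ * a) = 2⁻¹ * (b * a) := fun a b => by ring
  simp only [e1, e2, integral_const_mul]
  congr 1
  simp only [Finset.sum_mul, Finset.mul_sum]
  have int1 : ∀ i j, Integrable (fun ω : Metric.sphere (0 : EuclideanSpace ℝ (Fin n)) 1 =>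
      (fderiv ℝ v ω (rotGen i j (rotGen i j (ω : EuclideanSpace ℝ (Fin n)))) +
        fderiv ℝ (fderiv ℝ v) ω (rotGen i j (ω : EuclideanSpace ℝ (Fin n)))
          (rotGen i j (ω : EuclideanSpace ℝ (Fin n)))) * p ω)
      (volume : Measure (EuclideanSpace ℝ (Fin n))).toSphere := fun i j =>
    integrable_toSphere_of_continuousOn (f := fun x => (fderiv ℝ v x (rotGen i j (rotGen i j x)) +
        fderiv ℝ (fderiv ℝ v) x (rotGen i j x) (rotGen i j x)) * p x) hSU
      ((hc hv i j).mul hp.continuousOn)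
  have int2 : ∀ i j, Integrable (fun ω : Metric.sphere (0 : EuclideanSpace ℝ (Fin n)) 1 =>
      v ω * (fderiv ℝ p ω (rotGen i j (rotGen i j (ω : EuclideanSpace ℝ (Fin n)))) +
        fderiv ℝ (fderiv ℝ p) ω (rotGen i j (ω : EuclideanSpace ℝ (Fin n)))
          (rotGen i j (ω : EuclideanSpace ℝ (Fin n)))))
      (volume : Measure (EuclideanSpace ℝ (Fin n))).toSphere := fun i j =>
    integrable_toSphere_of_continuousOn (f := fun x => v x *
      (fderiv ℝ p x (rotGen i j (rotGen i j x)) +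
        fderiv ℝ (fderiv ℝ p) x (rotGen i j x) (rotGen i j x))) hSU
      (hv.continuousOn.mul (hc hp i j))
  rw [integral_finsetSum _ fun i _ => integrable_finsetSum _ fun j _ => int1 i j,
    integral_finsetSum _ fun i _ => integrable_finsetSum _ fun j _ => int2 i j]
  refine Finset.sum_congr rfl fun i _ => ?_
  rw [integral_finsetSum _ fun j _ => int1 i j, integral_finsetSum _ fun j _ => int2 i j]
  exact Finset.sum_congr rfl fun j _ =>
    integral_toSphere_second_deriv_skew _ (rotGen_mem_skewAdjoint i j) hU hSU hv hp

end Rotations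

/-! ### Homogeneous polynomials as test functions on the sphere. -/

section SpherePolynomials

open MeasureTheory Set

variable {n : ℕ}

/-- The complex-valued function on `ℝⁿ` defined by a real polynomial. -/
noncomputable def polyFun (P : MvPolynomial (Fin n) ℝ) (x : EuclideanSpace ℝ (Fin n)) : ℂ :=
  (MvPolynomial.eval (fun i => x i) P : ℝ)

theorem polyFun_add (P Q : MvPolynomial (Fin n) ℝ) (x : EuclideanSpace ℝ (Fin n)) :
    polyFun (P + Q) x = polyFun P x + polyFun Q x := by
  simp [polyFun]

theorem polyFun_mul (P Q : MvPolynomial (Fin n) ℝ) (x : EuclideanSpace ℝ (Fin n)) :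
    polyFun (P * Q) x = polyFun P x * polyFun Q x := by
  simp [polyFun]

theorem polyFun_X (i : Fin n) (x : EuclideanSpace ℝ (Fin n)) :
    polyFun (MvPolynomial.X i) x = (x i : ℂ) := by
  simp [polyFun]

theorem polyFun_sum {ι : Type*} (s : Finset ι) (P : ι → MvPolynomial (Fin n) ℝ)
    (x : EuclideanSpace ℝ (Fin n)) :
    polyFun (∑ k ∈ s, P k) x = ∑ k ∈ s, polyFun (P k) x := by
  simp [polyFun]

/-- The `i`-th coordinate as a complex-valued linear map. -/
noncomputable def complexCoord (i : Fin n) : EuclideanSpace ℝ (Fin n) →L[ℝ] ℂ :=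
  Complex.ofRealCLM.comp (EuclideanSpace.proj i)

@[simp]
theorem complexCoord_apply (i : Fin n) (x : EuclideanSpace ℝ (Fin n)) :
    complexCoord i x = (x i : ℂ) := rfl

theorem hasFDerivAt_polyFun (P : MvPolynomial (Fin n) ℝ) (x : EuclideanSpace ℝ (Fin n)) :
    HasFDerivAt (polyFun P)
      (∑ i, polyFun (MvPolynomial.pderiv i P) x • complexCoord i) x := by
  induction P using MvPolynomial.induction_on with
  | C a =>
    have h0 : polyFun (MvPolynomial.C a : MvPolynomial (Fin n) ℝ) = fun _ => (a : ℂ) := by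
      funext y; simp [polyFun]
    rw [h0]
    exact (hasFDerivAt_const (a : ℂ) x).congr_fderiv
      (ContinuousLinearMap.ext fun v => by simp [polyFun])
  | add P Q hP hQ =>
    rw [show polyFun (P + Q) = polyFun P + polyFun Q from funext (polyFun_add P Q)]
    exact (hP.add hQ).congr_fderiv (ContinuousLinearMap.ext fun v => by
      simp [polyFun_add, add_mul, Finset.sum_add_distrib])
  | mul_X P i hP =>
    rw [show polyFun (P * MvPolynomial.X i) = polyFun P * ⇑(complexCoord i) from
      funext fun y => by rw [polyFun_mul, polyFun_X]; rfl]
    refine (hP.mul (complexCoord i).hasFDerivAt).congr_fderiv (ContinuousLinearMap.ext fun v => ?_)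
    have hX : ∀ j, polyFun (MvPolynomial.pderiv j (MvPolynomial.X i)) x =
        if j = i then 1 else 0 := fun j => by
      by_cases hj : j = i
      · simp [hj, polyFun]
      · simp [MvPolynomial.pderiv_X_of_ne (Ne.symm hj), polyFun, hj]
    simp only [MvPolynomial.pderiv_mul, polyFun_add, polyFun_mul, polyFun_X, hX,
      _root_.add_apply, _root_.smul_apply, _root_.sum_apply, smul_eq_mul, complexCoord_apply,
      add_mul, Finset.sum_add_distrib, Finset.mul_sum]
    rw [add_comm]
    congr 1
    · exact Finset.sum_congr rfl fun j _ => by ring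
    · simp

theorem fderiv_polyFun (P : MvPolynomial (Fin n) ℝ) : fderiv ℝ (polyFun P) =
    fun x => ∑ i, polyFun (MvPolynomial.pderiv i P) x • complexCoord i :=
  funext fun x => (hasFDerivAt_polyFun P x).fderiv

theorem fderiv_polyFun_apply (P : MvPolynomial (Fin n) ℝ) (x v : EuclideanSpace ℝ (Fin n)) :
    fderiv ℝ (polyFun P) x v = ∑ i, (v i : ℂ) * polyFun (MvPolynomial.pderiv i P) x := by
  rw [fderiv_polyFun]
  simp [mul_comm]

theorem contDiff_polyFun (P : MvPolynomial (Fin n) ℝ) : ContDiff ℝ 2 (polyFun P) := by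
  induction P using MvPolynomial.induction_on with
  | C a =>
    have h0 : polyFun (MvPolynomial.C a : MvPolynomial (Fin n) ℝ) = fun _ => (a : ℂ) := by
      funext y; simp [polyFun]
    rw [h0]
    exact contDiff_const
  | add P Q hP hQ =>
    rw [show polyFun (P + Q) = polyFun P + polyFun Q from funext (polyFun_add P Q)]
    exact hP.add hQ
  | mul_X P i hP =>
    rw [show polyFun (P * MvPolynomial.X i) = polyFun P * ⇑(complexCoord i) from
      funext fun y => by rw [polyFun_mul, polyFun_X]; rfl]
    exact hP.mul (complexCoord i).contDiff

theorem fderiv_fderiv_polyFun_apply (P : MvPolynomial (Fin n) ℝ)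
    (x v w : EuclideanSpace ℝ (Fin n)) : fderiv ℝ (fderiv ℝ (polyFun P)) x v w =
      ∑ i, (w i : ℂ) * fderiv ℝ (polyFun (MvPolynomial.pderiv i P)) x v := by
  have h2 : HasFDerivAt (fderiv ℝ (polyFun P)) (fderiv ℝ (fderiv ℝ (polyFun P)) x) x :=
    ((((contDiff_polyFun P).fderiv_right (m := 1) (by norm_num)).differentiable
      one_ne_zero) x).hasFDerivAt
  have h3 := h2.clm_apply (hasFDerivAt_const w x)
  have h4 : HasFDerivAt (fun y => fderiv ℝ (polyFun P) y w)
      (∑ i, (w i : ℂ) • fderiv ℝ (polyFun (MvPolynomial.pderiv i P)) x) x := by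
    simp only [fderiv_polyFun_apply]
    exact HasFDerivAt.fun_sum fun i _ =>
      (((contDiff_polyFun _).differentiable two_ne_zero x).hasFDerivAt.const_mul _)
  simpa using congrArg (fun L => L v) (h3.unique h4)

/-- Euler's identity. -/
theorem MvPolynomial.IsHomogeneous.fderiv_polyFun_self {P : MvPolynomial (Fin n) ℝ} {d : ℕ}
    (hP : P.IsHomogeneous d) (x : EuclideanSpace ℝ (Fin n)) :
    fderiv ℝ (polyFun P) x x = d * polyFun P x := by
  have h := congrArg (fun Q => polyFun Q x) hP.sum_X_mul_pderiv
  simp only [polyFun_sum, polyFun_mul, polyFun_X] at h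
  rw [fderiv_polyFun_apply, h]
  simp [polyFun]

/-- The Laplacian of a polynomial. -/
noncomputable def polyLaplacian (P : MvPolynomial (Fin n) ℝ) : MvPolynomial (Fin n) ℝ :=
  ∑ k, MvPolynomial.pderiv k (MvPolynomial.pderiv k P)

theorem sum_fderiv_fderiv_polyFun (P : MvPolynomial (Fin n) ℝ) (x : EuclideanSpace ℝ (Fin n)) :
    ∑ k, fderiv ℝ (fderiv ℝ (polyFun P)) x (EuclideanSpace.single k 1)
      (EuclideanSpace.single k 1) = polyFun (polyLaplacian P) x := by
  simp [fderiv_fderiv_polyFun_apply, fderiv_polyFun_apply, polyLaplacian, polyFun_sum,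
    PiLp.single_apply, apply_ite Complex.ofReal]

/-- Euler's identity for P and for its partial derivatives. The truncation in `d - 1` is harmless,
since the factor d vanishes when d = 0. -/
theorem MvPolynomial.IsHomogeneous.fderiv_fderiv_polyFun_self {P : MvPolynomial (Fin n) ℝ} {d : ℕ}
    (hP : P.IsHomogeneous d) (x : EuclideanSpace ℝ (Fin n)) :
    fderiv ℝ (fderiv ℝ (polyFun P)) x x x = (d - 1 : ℕ) * (d * polyFun P x) := by
  simp only [fderiv_fderiv_polyFun_apply, hP.pderiv.fderiv_polyFun_self]
  rw [← hP.fderiv_polyFun_self, fderiv_polyFun_apply, Finset.mul_sum]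
  exact Finset.sum_congr rfl fun i _ => by ring

theorem MvPolynomial.IsHomogeneous.polyLaplacian {P : MvPolynomial (Fin n) ℝ} {d : ℕ}
    (hP : P.IsHomogeneous d) : (polyLaplacian P).IsHomogeneous (d - 1 - 1) :=
  MvPolynomial.IsHomogeneous.sum _ _ _ fun _ _ => hP.pderiv.pderiv

/-- Degree 0 is the one case where truncated subtraction of 2 does not lower the degree, so the
later induction on d needs it separately. -/
theorem MvPolynomial.IsHomogeneous.polyLaplacian_of_zero {P : MvPolynomial (Fin n) ℝ}
    (hP : P.IsHomogeneous 0) : _root_.polyLaplacian P = 0 := by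
  rw [MvPolynomial.totalDegree_eq_zero_iff_eq_C.1 (Nat.le_zero.1 hP.totalDegree_le)]
  simp [_root_.polyLaplacian]

/-- The spherical Laplacian, integrated against a homogeneous polynomial of degree `d`. -/
theorem integral_toSphere_sphericalLaplacian_mul_polyFun
    {U : Set (EuclideanSpace ℝ (Fin n))} (hU : IsOpen U)
    (hSU : Metric.sphere (0 : EuclideanSpace ℝ (Fin n)) 1 ⊆ U)
    {v : EuclideanSpace ℝ (Fin n) → ℂ} (hv : ContDiffOn ℝ 2 v U)
    {P : MvPolynomial (Fin n) ℝ} {d : ℕ} (hP : P.IsHomogeneous d) :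
    ∫ ω : Metric.sphere (0 : EuclideanSpace ℝ (Fin n)) 1,
        (∑ k, fderiv ℝ (fderiv ℝ v) ω (EuclideanSpace.single k 1) (EuclideanSpace.single k 1)
          - fderiv ℝ (fderiv ℝ v) ω ω ω - ((n : ℂ) - 1) * fderiv ℝ v ω ω) * polyFun P ω
        ∂(volume : Measure (EuclideanSpace ℝ (Fin n))).toSphere =
      ∫ ω : Metric.sphere (0 : EuclideanSpace ℝ (Fin n)) 1, v ω * polyFun (polyLaplacian P) ω
        ∂(volume : Measure (EuclideanSpace ℝ (Fin n))).toSphere -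
      (d * ((d - 1 : ℕ) + ((n : ℝ) - 1)) : ℝ) *
        ∫ ω : Metric.sphere (0 : EuclideanSpace ℝ (Fin n)) 1, v ω * polyFun P ω
        ∂(volume : Measure (EuclideanSpace ℝ (Fin n))).toSphere := by
  rw [integral_toSphere_sphericalLaplacian hU hSU hv (contDiff_polyFun P).contDiffOn,
    ← integral_const_mul, ← integral_sub]
  · refine integral_congr_ae (.of_forall fun ω => ?_)
    simp only [sum_fderiv_fderiv_polyFun, hP.fderiv_fderiv_polyFun_self, hP.fderiv_polyFun_self]
    push_cast
    ring
  · exact integrable_toSphere_of_continuousOn (f := fun x => v x * polyFun (polyLaplacian P) x) hSU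
      (hv.continuousOn.mul (contDiff_polyFun _).continuous.continuousOn)
  · exact (integrable_toSphere_of_continuousOn (f := fun x => v x * polyFun P x) hSU
      (hv.continuousOn.mul (contDiff_polyFun _).continuous.continuousOn)).const_mul _

/-- A continuous function on the unit sphere orthogonal to all homogeneous polynomials vanishes. -/
theorem eq_zero_of_integral_toSphere_mul_polyFun
    {v : Metric.sphere (0 : EuclideanSpace ℝ (Fin n)) 1 → ℂ} (hv : Continuous v)
    (h : ∀ (d : ℕ) (P : MvPolynomial (Fin n) ℝ), P.IsHomogeneous d →
      ∫ ω, v ω * polyFun P ω ∂(volume : Measure (EuclideanSpace ℝ (Fin n))).toSphere = 0) :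
    v = 0 := by
  set σ := (volume : Measure (EuclideanSpace ℝ (Fin n))).toSphere
  have hint : ∀ {f : Metric.sphere (0 : EuclideanSpace ℝ (Fin n)) 1 → ℂ}, Continuous f →
      Integrable f σ := fun hf =>
    hf.integrable_of_hasCompactSupport (HasCompactSupport.of_compactSpace _)
  have hintR : ∀ {f : Metric.sphere (0 : EuclideanSpace ℝ (Fin n)) 1 → ℝ}, Continuous f →
      Integrable f σ := fun hf =>
    hf.integrable_of_hasCompactSupport (HasCompactSupport.of_compactSpace _)
  have hpc : ∀ P, Continuous fun ω : Metric.sphere (0 : EuclideanSpace ℝ (Fin n)) 1 =>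
      polyFun P (ω : EuclideanSpace ℝ (Fin n)) := fun P =>
    (contDiff_polyFun P).continuous.comp continuous_subtype_val
  have hall : ∀ P : MvPolynomial (Fin n) ℝ, ∫ ω, v ω * polyFun P ω ∂σ = 0 := by
    intro P
    have hsum : ∀ ω : Metric.sphere (0 : EuclideanSpace ℝ (Fin n)) 1, v ω * polyFun P ω =
        ∑ i ∈ Finset.range (P.totalDegree + 1),
          v ω * polyFun (MvPolynomial.homogeneousComponent i P) ω := fun ω => by
      rw [← Finset.mul_sum, ← polyFun_sum, MvPolynomial.sum_homogeneousComponent]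
    simp only [hsum]
    rw [integral_finsetSum _ fun i _ => hint
      (f := fun ω => v ω * polyFun (MvPolynomial.homogeneousComponent i P) ω) (hv.mul (hpc _))]
    exact Finset.sum_eq_zero fun i _ =>
      h i _ (MvPolynomial.homogeneousComponent_isHomogeneous i P)
  -- Stone-Weierstrass: the functional `f ↦ ∫ w f` is continuous and kills the dense algebra of
  -- polynomials, so it kills w itself.
  have hreal : ∀ w : C(Metric.sphere (0 : EuclideanSpace ℝ (Fin n)) 1, ℝ),
      (∀ P : MvPolynomial (Fin n) ℝ,
        ∫ ω, w ω * MvPolynomial.eval (fun i => (ω : EuclideanSpace ℝ (Fin n)) i) P ∂σ = 0) →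
      w = 0 := by
    intro w hw
    let X : Fin n → C(Metric.sphere (0 : EuclideanSpace ℝ (Fin n)) 1, ℝ) := fun i =>
      ⟨fun ω => (ω : EuclideanSpace ℝ (Fin n)) i, by fun_prop⟩
    let A : Subalgebra ℝ C(Metric.sphere (0 : EuclideanSpace ℝ (Fin n)) 1, ℝ) :=
      (MvPolynomial.aeval X).range
    have hA : A.SeparatesPoints := by
      intro x y hxy
      have : ∃ i, (x : EuclideanSpace ℝ (Fin n)) i ≠ (y : EuclideanSpace ℝ (Fin n)) i := by
        by_contra! hc
        exact hxy (Subtype.ext (PiLp.ext hc))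
      obtain ⟨i, hi⟩ := this
      exact ⟨X i, ⟨X i, ⟨MvPolynomial.X i, by simp⟩, rfl⟩, hi⟩
    have heval : ∀ (P : MvPolynomial (Fin n) ℝ) ω, MvPolynomial.aeval X P ω =
        MvPolynomial.eval (fun i => (ω : EuclideanSpace ℝ (Fin n)) i) P := by
      intro P ω
      induction P using MvPolynomial.induction_on with
      | C a => simp
      | add P Q hP hQ => simp [hP, hQ]
      | mul_X P i hP => simp [hP, X]
    let L : C(Metric.sphere (0 : EuclideanSpace ℝ (Fin n)) 1, ℝ) → ℝ := fun f => ∫ ω, w ω * f ω ∂σ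
    have hL : Continuous L := by
      have hcomp : Continuous fun f : C(Metric.sphere (0 : EuclideanSpace ℝ (Fin n)) 1, ℝ) =>
          ∫ ω, (ContinuousMap.toLp (E := ℝ) 1 σ ℝ (w * f)) ω ∂σ :=
        continuous_integral.comp
          ((ContinuousMap.toLp (E := ℝ) 1 σ ℝ).continuous.comp (continuous_const.mul continuous_id))
      refine hcomp.congr fun f => ?_
      exact integral_congr_ae (ContinuousMap.coeFn_toLp (𝕜 := ℝ) σ (w * f))
    have hclosed : IsClosed {f | L f = 0} := isClosed_eq hL continuous_const
    have hAsub : (A : Set C(Metric.sphere (0 : EuclideanSpace ℝ (Fin n)) 1, ℝ)) ⊆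
        {f | L f = 0} := by
      rintro _ ⟨P, rfl⟩
      simpa [L, heval] using hw P
    have hw2 : L w = 0 := by
      refine (closure_minimal hAsub hclosed) ?_
      rw [← Subalgebra.topologicalClosure_coe,
        ContinuousMap.subalgebra_topologicalClosure_eq_top_of_separatesPoints A hA]
      trivial
    -- A continuous function vanishing almost everywhere is zero, as the sphere measure charges
    -- every nonempty open set.
    have hsq : (fun ω => w ω * w ω) = 0 :=
      (Continuous.ae_eq_iff_eq σ (by fun_prop) continuous_zero).1
        ((integral_eq_zero_iff_of_nonneg (fun ω => mul_self_nonneg (w ω))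
          (hintR (by fun_prop))).1 hw2)
    ext ω
    simpa using congrFun hsq ω
  have hre : ∀ P : MvPolynomial (Fin n) ℝ, ∫ ω, (v ω).re *
      MvPolynomial.eval (fun i => (ω : EuclideanSpace ℝ (Fin n)) i) P ∂σ = 0 := by
    intro P
    have := congrArg Complex.re (hall P)
    rw [← RCLike.re_eq_complex_re, ← integral_re (hint (f := fun ω => v ω * polyFun P ω) (hv.mul (hpc P)))] at this
    simpa [polyFun] using this
  have him : ∀ P : MvPolynomial (Fin n) ℝ, ∫ ω, (v ω).im *
      MvPolynomial.eval (fun i => (ω : EuclideanSpace ℝ (Fin n)) i) P ∂σ = 0 := by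
    intro P
    have := congrArg Complex.im (hall P)
    rw [← RCLike.im_eq_complex_im, ← integral_im (hint (f := fun ω => v ω * polyFun P ω) (hv.mul (hpc P)))] at this
    simpa [polyFun] using this
  have h1 := hreal ⟨fun ω => (v ω).re, by fun_prop⟩ hre
  have h2 := hreal ⟨fun ω => (v ω).im, by fun_prop⟩ him
  funext ω
  exact Complex.ext (congrArg (fun f => f ω) h1) (congrArg (fun f => f ω) h2)

end SpherePolynomials

/-! ### Solutions of w'' = (q - μ²) w that tend to zero at infinity. -/

section DecayingODE

open Set Filter

/-- A function tending to zero at infinity, whose derivative is bounded by `K e^{-s}`, is bounded by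
`K e^{-s}`. -/
theorem norm_le_mul_exp_neg_of_tendsto_zero {f f' : ℝ → ℂ} {ρ K : ℝ}
    (hf : ∀ s, ρ ≤ s → HasDerivAt f (f' s) s) (hb : ∀ s, ρ ≤ s → ‖f' s‖ ≤ K * Real.exp (-s))
    (hlim : Tendsto f atTop (𝓝 0)) {s : ℝ} (hs : ρ ≤ s) : ‖f s‖ ≤ K * Real.exp (-s) := by
  have hK : 0 ≤ K := by
    have := (norm_nonneg _).trans (hb ρ le_rfl)
    exact nonneg_of_mul_nonneg_left this (Real.exp_pos _)
  have hbd : ∀ t, s ≤ t → ‖f t - f s‖ ≤ K * Real.exp (-s) := by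
    intro t ht
    -- The comparison function B is the integral of K e^(-y) from s to x. It stays below K e^(-s),
    -- which allows t → ∞ afterwards.
    have h := image_norm_le_of_norm_deriv_right_le_deriv_boundary (a := s) (b := t)
      (f := fun x => f x - f s) (f' := f')
      (B := fun x => K * (Real.exp (-s) - Real.exp (-x))) (B' := fun x => K * Real.exp (-x))
      (fun x hx => ((hf x (hs.trans hx.1)).sub_const _).continuousAt.continuousWithinAt)
      (fun x hx => ((hf x (hs.trans hx.1)).sub_const _).hasDerivWithinAt)
      (by simp)
      (fun x => by
        have := (((hasDerivAt_neg x).exp).const_sub (Real.exp (-s))).const_mul K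
        simpa using this)
      (fun x hx => hb x (hs.trans hx.1)) (right_mem_Icc.2 ht)
    refine h.trans (mul_le_mul_of_nonneg_left ?_ hK)
    linarith [Real.exp_pos (-t)]
  have hl : Tendsto (fun t => ‖f t - f s‖) atTop (𝓝 ‖0 - f s‖) := (hlim.sub_const _).norm
  have := le_of_tendsto hl (eventually_atTop.2 ⟨s, hbd⟩)
  simpa using this

/-- If a function and its second derivative tend to zero at infinity, so does its derivative. -/
theorem tendsto_deriv_zero_of_tendsto_zero {w w' w'' : ℝ → ℂ} {a : ℝ}
    (hw : ∀ s, a < s → HasDerivAt w (w' s) s) (hw' : ∀ s, a < s → HasDerivAt w' (w'' s) s)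
    (hlim : Tendsto w atTop (𝓝 0)) (hlim'' : Tendsto w'' atTop (𝓝 0)) :
    Tendsto w' atTop (𝓝 0) := by
  rw [Metric.tendsto_atTop]
  intro ε hε
  obtain ⟨N₁, hN₁⟩ := Metric.tendsto_atTop.1 hlim (ε / 4) (by positivity)
  obtain ⟨N₂, hN₂⟩ := Metric.tendsto_atTop.1 hlim'' (ε / 4) (by positivity)
  refine ⟨max (max N₁ N₂) (a + 1), fun s hs => ?_⟩
  have hs1 : N₁ ≤ s := (le_max_left _ _).trans ((le_max_left _ _).trans hs)
  have hs2 : N₂ ≤ s := (le_max_right _ _).trans ((le_max_left _ _).trans hs)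
  have hs3 : a < s := by linarith [(le_max_right (max N₁ N₂) (a + 1)).trans hs]
  have h1 : ∀ t ∈ Icc s (s + 1), ‖w' t - w' s‖ ≤ ε / 4 := by
    intro t ht
    have := norm_image_sub_le_of_norm_deriv_right_le_segment (f := w') (f' := w'') (C := ε / 4)
      (a := s) (b := s + 1)
      (fun x hx => (hw' x (hs3.trans_le hx.1)).continuousAt.continuousWithinAt)
      (fun x hx => (hw' x (hs3.trans_le hx.1)).hasDerivWithinAt)
      (fun x hx => by simpa using (hN₂ x (hs2.trans hx.1)).le) t ht
    refine this.trans ?_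
    nlinarith [ht.2]
  have h2 := norm_image_sub_le_of_norm_deriv_right_le_segment
      (f := fun t => w t - (t : ℂ) * w' s) (f' := fun t => w' t - w' s) (C := ε / 4)
      (a := s) (b := s + 1)
      (fun x hx => ((hw x (hs3.trans_le hx.1)).continuousAt.sub
        (by fun_prop)).continuousWithinAt)
      (fun x hx => by
        have := (hw x (hs3.trans_le hx.1)).fun_sub
          ((Complex.ofRealCLM.hasDerivAt (x := x)).mul_const (w' s))
        simpa using this.hasDerivWithinAt)
      (fun x hx => h1 x (Ico_subset_Icc_self hx)) (s + 1) (right_mem_Icc.2 (by linarith))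
  -- First-order Taylor expansion over a unit step. The remainder and the two values of w are each
  -- at most ε/4.
  have h3 : w' s = w (s + 1) - w s -
      ((w (s + 1) - ((s + 1 : ℝ) : ℂ) * w' s) - (w s - (s : ℂ) * w' s)) := by
    push_cast; ring
  have h4 : ‖w (s + 1)‖ < ε / 4 := by simpa using hN₁ (s + 1) (by linarith)
  have h5 : ‖w s‖ < ε / 4 := by simpa using hN₁ s hs1
  rw [dist_zero_right, h3]
  refine (norm_sub_le _ _).trans_lt ?_
  have h6 := norm_sub_le (w (s + 1)) (w s)
  have h7 : ε / 4 * (s + 1 - s) = ε / 4 := by ring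
  rw [h7] at h2
  linarith

/-- A solution of `w'' = (q - μ²) w` with an exponentially decaying potential `q` that tends to zero
at infinity vanishes near infinity. -/
theorem eventually_eq_zero_of_ode {w w' : ℝ → ℂ} {q : ℝ → ℝ} {μ a C : ℝ}
    (hw : ∀ s, a < s → HasDerivAt w (w' s) s)
    (hw' : ∀ s, a < s → HasDerivAt w' (((q s : ℂ) - (μ : ℂ) ^ 2) * w s) s)
    (hq : ∀ᶠ s in atTop, |q s| ≤ C * Real.exp (-s)) (hlim : Tendsto w atTop (𝓝 0)) :
    ∃ b, a < b ∧ ∀ s, b ≤ s → w s = 0 := by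
  have hexp : Tendsto (fun s : ℝ => C * Real.exp (-s)) atTop (𝓝 0) := by
    simpa using (Real.tendsto_exp_neg_atTop_nhds_zero).const_mul C
  have hq0 : Tendsto (fun s => (q s : ℂ)) atTop (𝓝 0) := by
    have : Tendsto q atTop (𝓝 0) := squeeze_zero_norm' hq hexp
    simpa [Function.comp_def] using (Complex.continuous_ofReal.tendsto 0).comp this
  have hlim' : Tendsto w' atTop (𝓝 0) := by
    refine tendsto_deriv_zero_of_tendsto_zero hw hw' hlim ?_
    simpa using (hq0.sub_const ((μ : ℂ) ^ 2)).mul hlim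
  have hsmall : ∀ᶠ s in atTop, C * Real.exp (-s) < 1 / 2 :=
    hexp.eventually_lt_const (by norm_num)
  have hw1 : ∀ᶠ s in atTop, ‖w s‖ < 1 := by
    have := hlim.norm
    rw [norm_zero] at this
    exact this.eventually_lt_const one_pos
  obtain ⟨b, hb⟩ := eventually_atTop.1
    ((hq.and hsmall).and (hw1.and (eventually_gt_atTop a)))
  refine ⟨b, (hb b le_rfl).2.2, ?_⟩
  have hep : ∀ (c : ℂ) (s : ℝ), HasDerivAt (fun s : ℝ => Complex.exp (c * s))
      (c * Complex.exp (c * s)) s := fun c s => by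
    have := (((hasDerivAt_id (s : ℂ)).const_mul c).cexp).comp_ofReal
    simpa [mul_comm] using this
  have hen : ∀ (c s : ℝ), ‖Complex.exp (Complex.I * c * s)‖ = 1 := fun c s => by
    rw [show Complex.I * c * s = ((c * s : ℝ) : ℂ) * Complex.I by push_cast; ring]
    exact Complex.norm_exp_ofReal_mul_I _
  have hbdd : ∀ (c : ℝ) {f : ℝ → ℂ}, Tendsto f atTop (𝓝 0) →
      Tendsto (fun s : ℝ => Complex.exp (Complex.I * c * s) * f s) atTop (𝓝 0) := fun c f hf => by
    rw [tendsto_zero_iff_norm_tendsto_zero] at hf ⊢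
    simpa [hen] using hf
  -- The bound improves itself. Since w'' + μ² w = q w, the function e^(iμt)(w' - iμw) has
  -- derivative e^(iμt) q w, and e^(-iμt) w has derivative e^(-iμt)(w' - iμw). Integrating each from
  -- infinity gives |w(s)| ≤ C M e^(-s), and b was chosen so that C e^(-s) < 1/2.
  have step : ∀ M : ℝ, (∀ s, b ≤ s → ‖w s‖ ≤ M) → ∀ s, b ≤ s → ‖w s‖ ≤ M / 2 := by
    intro M hM s hs
    have hM0 : 0 ≤ M := (norm_nonneg _).trans (hM b le_rfl)
    have h1 : ∀ t, b ≤ t → ‖w' t - Complex.I * μ * w t‖ ≤ C * M * Real.exp (-t) := by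
      intro t ht
      have := norm_le_mul_exp_neg_of_tendsto_zero (ρ := b) (K := C * M)
        (f := fun t : ℝ => Complex.exp (Complex.I * μ * t) * (w' t - Complex.I * μ * w t))
        (f' := fun t : ℝ => Complex.exp (Complex.I * μ * t) * (q t * w t))
        (fun t ht => by
          have hta := (hb t ht).2.2
          have := (hep (Complex.I * μ) t).mul
            ((hw' t hta).sub ((hw t hta).const_mul (Complex.I * μ)))
          convert! this using 1
          simp only [Pi.sub_apply]
          linear_combination ((μ : ℂ) ^ 2 * w t * Complex.exp (Complex.I * μ * t)) * Complex.I_sq)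
        (fun t ht => by
          rw [norm_mul, hen, one_mul, norm_mul, Complex.norm_real, Real.norm_eq_abs]
          calc |q t| * ‖w t‖ ≤ (C * Real.exp (-t)) * M :=
                mul_le_mul (hb t ht).1.1 (hM t ht) (norm_nonneg _)
                  ((abs_nonneg _).trans (hb t ht).1.1)
            _ = _ := by ring)
        (hbdd μ (by simpa using hlim'.sub (hlim.const_mul (Complex.I * μ)))) ht
      rwa [norm_mul, hen, one_mul] at this
    have h2 := norm_le_mul_exp_neg_of_tendsto_zero (ρ := b) (K := C * M)
      (f := fun t : ℝ => Complex.exp (Complex.I * (-μ : ℝ) * t) * w t)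
      (f' := fun t : ℝ => Complex.exp (Complex.I * (-μ : ℝ) * t) * (w' t - Complex.I * μ * w t))
      (fun t ht => by
        have := (hep (Complex.I * (-μ : ℝ)) t).mul (hw t (hb t ht).2.2)
        convert! this using 1
        push_cast
        ring)
      (fun t ht => by rw [norm_mul, hen, one_mul]; exact h1 t ht)
      (hbdd (-μ) hlim) hs
    rw [norm_mul, hen, one_mul] at h2
    have h3 := (hb s hs).1.2
    nlinarith
  have hpow : ∀ k : ℕ, ∀ s, b ≤ s → ‖w s‖ ≤ (1 / 2 : ℝ) ^ k := by
    intro k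
    induction k with
    | zero => exact fun s hs => by simpa using (hb s hs).2.1.le
    | succ k ih =>
      intro s hs
      rw [pow_succ, mul_one_div]
      exact step _ ih s hs
  intro s hs
  have := ge_of_tendsto' (tendsto_pow_atTop_nhds_zero_of_lt_one (r := (1 / 2 : ℝ))
    (by norm_num) (by norm_num)) fun k => hpow k s hs
  simpa using this

/-- A solution of `w'' = (q - μ²) w` with an exponentially decaying potential `q` that tends to zero
at infinity vanishes. -/
theorem eq_zero_of_ode_of_tendsto_zero {w w' : ℝ → ℂ} {q : ℝ → ℝ} {μ a C : ℝ}
    (hw : ∀ s, a < s → HasDerivAt w (w' s) s)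
    (hw' : ∀ s, a < s → HasDerivAt w' (((q s : ℂ) - (μ : ℂ) ^ 2) * w s) s)
    (hqc : ContinuousOn q (Ioi a))
    (hq : ∀ᶠ s in atTop, |q s| ≤ C * Real.exp (-s)) (hlim : Tendsto w atTop (𝓝 0))
    {s : ℝ} (hs : a < s) : w s = 0 := by
  obtain ⟨b, hab, hb⟩ := eventually_eq_zero_of_ode hw hw' hq hlim
  rcases le_or_gt b s with h | h
  · exact hb s h
  have hsub : Icc s (b + 1) ⊆ Ioi a := fun t ht => hs.trans_le ht.1
  obtain ⟨D, hD⟩ := isCompact_Icc.exists_bound_of_continuousOn (s := Icc s (b + 1))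
    (f := fun t => (q t : ℂ) - (μ : ℂ) ^ 2)
    ((Complex.continuous_ofReal.comp_continuousOn (hqc.mono hsub)).sub continuousOn_const)
  -- At b + 1, unlike at b, the solution is known to vanish on both sides, so its derivative is zero
  -- there.
  have hw0 : w' (b + 1) = 0 := by
    refine (hw (b + 1) (by linarith)).unique ?_
    refine (hasDerivAt_const (b + 1) (0 : ℂ)).congr_of_eventuallyEq ?_
    filter_upwards [Ioi_mem_nhds (show b < b + 1 by linarith)] with t ht
    exact hb t (le_of_lt ht)
  -- Backward uniqueness for the first-order system of (w, w'), whose Lipschitz constant comes from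
  -- the bound D on the potential over a compact interval.
  have key := ODE_solution_unique_of_mem_Icc_left (K := max 1 D.toNNReal) (a := s) (b := b + 1)
    (v := fun t (p : ℂ × ℂ) => (p.2, ((q t : ℂ) - (μ : ℂ) ^ 2) * p.1)) (s := fun _ => univ)
    (f := fun t => (w t, w' t)) (g := fun _ => (0, 0))
    (fun t ht => by
      refine LipschitzWith.lipschitzOnWith ?_
      refine LipschitzWith.prodMk LipschitzWith.prod_snd ?_
      have hl : LipschitzWith D.toNNReal fun z : ℂ => ((q t : ℂ) - (μ : ℂ) ^ 2) * z := by
        refine LipschitzWith.of_dist_le_mul fun x y => ?_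
        rw [dist_eq_norm, dist_eq_norm, ← mul_sub, norm_mul]
        refine mul_le_mul_of_nonneg_right ?_ (norm_nonneg _)
        exact (hD t (Ioc_subset_Icc_self ht)).trans (Real.le_coe_toNNReal D)
      simpa [Function.comp_def] using hl.comp LipschitzWith.prod_fst)
    (fun t ht => ((hw t (hsub ht)).continuousAt.prodMk
      (hw' t (hsub ht)).continuousAt).continuousWithinAt)
    (fun t ht => ((hw t (hsub (Ioc_subset_Icc_self ht))).prodMk
      (hw' t (hsub (Ioc_subset_Icc_self ht)))).hasDerivWithinAt)
    (fun _ _ => mem_univ _) continuousOn_const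
    (fun t ht => by
      rw [mul_zero]
      exact (hasDerivAt_const t ((0 : ℂ), (0 : ℂ))).hasDerivWithinAt)
    (fun _ _ => mem_univ _)
    (by simp [hb (b + 1) (by linarith), hw0])
  exact congrArg Prod.fst (key ⟨le_rfl, by linarith⟩)

end DecayingODE

/-! ### Hyperbolic polar coordinates, with Euclidean radius tanh(s/2). -/

section HyperbolicPolar

open MeasureTheory Set Filter

theorem tanh_half_mem_Ioo {s : ℝ} (hs : 0 < s) : Real.tanh (s / 2) ∈ Ioo (0 : ℝ) 1 := by
  have h1 : 0 < Real.sinh (s / 2) := Real.sinh_pos_iff.2 (by positivity)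
  have h2 := Real.cosh_pos (s / 2)
  rw [Real.tanh_eq_sinh_div_cosh]
  exact ⟨by positivity, (div_lt_one h2).2 (Real.sinh_lt_cosh _)⟩

theorem sinh_eq_tanh_half (s : ℝ) :
    Real.sinh s = 2 * Real.tanh (s / 2) / (1 - Real.tanh (s / 2) ^ 2) := by
  have h2 := Real.cosh_pos (s / 2)
  have h3 := Real.cosh_sq (s / 2)
  have h4 : 1 - Real.tanh (s / 2) ^ 2 = 1 / Real.cosh (s / 2) ^ 2 := by
    rw [Real.tanh_eq_sinh_div_cosh]; field_simp; linarith
  have h5 : Real.sinh s = 2 * Real.sinh (s / 2) * Real.cosh (s / 2) := by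
    rw [← Real.sinh_two_mul]; ring_nf
  rw [h4, h5, Real.tanh_eq_sinh_div_cosh]
  field_simp

theorem cosh_eq_tanh_half (s : ℝ) :
    Real.cosh s = (1 + Real.tanh (s / 2) ^ 2) / (1 - Real.tanh (s / 2) ^ 2) := by
  have h2 := Real.cosh_pos (s / 2)
  have h3 := Real.cosh_sq (s / 2)
  have h4 : 1 - Real.tanh (s / 2) ^ 2 = 1 / Real.cosh (s / 2) ^ 2 := by
    rw [Real.tanh_eq_sinh_div_cosh]; field_simp; linarith
  have h5 : Real.cosh s = Real.cosh (s / 2) ^ 2 + Real.sinh (s / 2) ^ 2 := by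
    rw [← Real.cosh_two_mul]; ring_nf
  rw [h4, h5, Real.tanh_eq_sinh_div_cosh]
  field_simp

theorem hasDerivAt_tanh_half (s : ℝ) :
    HasDerivAt (fun s : ℝ => Real.tanh (s / 2)) ((1 - Real.tanh (s / 2) ^ 2) / 2) s := by
  have h2 := Real.cosh_pos (s / 2)
  have hd : HasDerivAt (fun s : ℝ => s / 2) (1 / 2) s := (hasDerivAt_id s).div_const 2
  have h : HasDerivAt (fun s : ℝ => Real.sinh (s / 2) / Real.cosh (s / 2)) _ s :=
    hd.sinh.fun_div hd.cosh h2.ne'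
  simp only [Real.tanh_eq_sinh_div_cosh]
  convert h using 1
  field_simp

variable {n : ℕ}

theorem hypRho_eq_two_mul_artanh {x : EuclideanSpace ℝ (Fin n)} (hx : ‖x‖ < 1) :
    hypRho x = 2 * Real.artanh ‖x‖ := by
  rw [Real.artanh_eq_half_log ⟨by linarith [norm_nonneg x], hx.le⟩, hypRho]
  ring

theorem tanh_half_hypRho {x : EuclideanSpace ℝ (Fin n)} (hx : ‖x‖ < 1) :
    Real.tanh (hypRho x / 2) = ‖x‖ := by
  rw [hypRho_eq_two_mul_artanh hx, mul_div_cancel_left₀ _ two_ne_zero,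
    Real.tanh_artanh ⟨by linarith [norm_nonneg x], hx⟩]

theorem hypRho_of_norm_eq_tanh {x : EuclideanSpace ℝ (Fin n)} {s : ℝ}
    (hs : 0 < s) (hx : ‖x‖ = Real.tanh (s / 2)) : hypRho x = s := by
  rw [hypRho_eq_two_mul_artanh (hx ▸ (tanh_half_mem_Ioo hs).2), hx, Real.artanh_tanh]
  ring

theorem isOpen_hypExterior (R₀ : ℝ) : IsOpen (poincareBall n \ hypClosedBall n R₀) := by
  have hball : IsOpen (poincareBall n) := isOpen_lt continuous_norm continuous_const
  have hc : ContinuousOn (hypRho (n := n)) (poincareBall n) := by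
    refine ContinuousOn.log (ContinuousOn.div (by fun_prop) (by fun_prop) ?_) ?_
    · intro x hx
      have : ‖x‖ < 1 := hx
      linarith
    · intro x hx
      have h1 : ‖x‖ < 1 := hx
      have := norm_nonneg x
      exact (div_pos (by linarith) (by linarith)).ne'
  convert hc.isOpen_inter_preimage hball (isOpen_Ioi (a := R₀)) using 1
  ext x
  simp only [hypClosedBall, Set.mem_sdiff, mem_ofPred_eq, mem_inter_iff, mem_preimage, mem_Ioi]
  refine and_congr_right fun hx => ?_
  simp [hx]

theorem tanh_smul_mem_hypExterior {R₀ s : ℝ} (hR₀ : 0 < R₀) (hs : R₀ < s)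
    (ω : Metric.sphere (0 : EuclideanSpace ℝ (Fin n)) 1) :
    Real.tanh (s / 2) • (ω : EuclideanSpace ℝ (Fin n)) ∈
      poincareBall n \ hypClosedBall n R₀ := by
  obtain ⟨h0, h1⟩ := tanh_half_mem_Ioo (hR₀.trans hs)
  have hn : ‖Real.tanh (s / 2) • (ω : EuclideanSpace ℝ (Fin n))‖ = Real.tanh (s / 2) := by
    rw [norm_smul, norm_eq_of_mem_sphere, mul_one, Real.norm_eq_abs, abs_of_pos h0]
  refine ⟨by rw [poincareBall, mem_ofPred_eq, hn]; exact h1, fun h => ?_⟩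
  have h2 := h.2
  rw [hypRho_of_norm_eq_tanh (hR₀.trans hs) hn] at h2
  linarith

/-- The surface integral over a hyperbolic sphere in polar coordinates. -/
theorem integral_hypSphereMeasure {s : ℝ} (hs : 0 < s) (f : EuclideanSpace ℝ (Fin n) → ℝ) :
    ∫ x, f x ∂(hypSphereMeasure n s) = Real.sinh s ^ (n - 1) *
      ∫ ω : Metric.sphere (0 : EuclideanSpace ℝ (Fin n)) 1,
        f (Real.tanh (s / 2) • (ω : EuclideanSpace ℝ (Fin n)))
        ∂(volume : Measure (EuclideanSpace ℝ (Fin n))).toSphere := by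
  obtain ⟨h0, h1⟩ := tanh_half_mem_Ioo hs
  have hemb : MeasurableEmbedding (fun ω : Metric.sphere (0 : EuclideanSpace ℝ (Fin n)) 1 =>
      Real.tanh (s / 2) • (ω : EuclideanSpace ℝ (Fin n))) :=
    ((Homeomorph.smulOfNeZero _ h0.ne').measurableEmbedding).comp
      (MeasurableEmbedding.subtype_coe Metric.isClosed_sphere.measurableSet)
  rw [hypSphereMeasure, integral_withDensity_eq_integral_toReal_smul (by fun_prop)
    (.of_forall fun _ => ENNReal.ofReal_lt_top), euclSphereMeasure, integral_smul_measure,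
    hemb.integral_map, ← integral_const_mul, smul_eq_mul, ← integral_const_mul]
  refine integral_congr_ae (.of_forall fun ω => ?_)
  have hn : ‖Real.tanh (s / 2) • (ω : EuclideanSpace ℝ (Fin n))‖ = Real.tanh (s / 2) := by
    rw [norm_smul, norm_eq_of_mem_sphere, mul_one, Real.norm_eq_abs, abs_of_pos h0]
  have hp : 0 < 1 - Real.tanh (s / 2) ^ 2 := by nlinarith
  simp only [hn, smul_eq_mul]
  rw [ENNReal.toReal_ofReal (by positivity), ENNReal.toReal_ofReal (by positivity), ← mul_assoc,
    ← mul_pow, sinh_eq_tanh_half]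
  congr 2
  ring

/-- Boundedness of p followed by Cauchy-Schwarz against the constant 1. It lets the L² norm of u on
a sphere control each coefficient, with C independent of the radius. -/
theorem sq_norm_integral_mul_le {Ω : Type*} [TopologicalSpace Ω]
    [CompactSpace Ω] [MeasurableSpace Ω] [BorelSpace Ω] [SecondCountableTopology Ω]
    (σ : Measure Ω) [IsFiniteMeasure σ] {p : Ω → ℂ} (hp : Continuous p) :
    ∃ C, 0 ≤ C ∧ ∀ f : Ω → ℂ, Continuous f →
      ‖∫ ω, f ω * p ω ∂σ‖ ^ 2 ≤ C * ∫ ω, ‖f ω‖ ^ 2 ∂σ := by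
  obtain ⟨B, hB⟩ := isCompact_univ.exists_bound_of_continuousOn hp.continuousOn
  have hB' : ∀ ω, ‖p ω‖ ≤ |B| := fun ω => (hB ω (mem_univ ω)).trans (le_abs_self B)
  refine ⟨|B| ^ 2 * σ.real univ, by positivity, fun f hf => ?_⟩
  have hint : ∀ {g : Ω → ℝ}, Continuous g → Integrable g σ := fun hg =>
    hg.integrable_of_hasCompactSupport (HasCompactSupport.of_compactSpace _)
  have h1 : ‖∫ ω, f ω * p ω ∂σ‖ ≤ |B| * ∫ ω, ‖f ω‖ ∂σ := by
    rw [← integral_const_mul]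
    refine norm_integral_le_of_norm_le (hint (by fun_prop)) (.of_forall fun ω => ?_)
    rw [norm_mul, mul_comm]
    exact mul_le_mul_of_nonneg_right (hB' ω) (norm_nonneg _)
  have h2 : (∫ ω, ‖f ω‖ ∂σ) ^ 2 ≤ σ.real univ * ∫ ω, ‖f ω‖ ^ 2 ∂σ := by
    -- Cauchy-Schwarz from the discriminant of the nonnegative quadratic t ↦ ∫ (t - ‖f‖)².
    have hd := discrim_le_zero (a := σ.real univ) (b := -2 * ∫ ω, ‖f ω‖ ∂σ)
      (c := ∫ ω, ‖f ω‖ ^ 2 ∂σ) fun t => by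
        have h3 : 0 ≤ ∫ ω, (t - ‖f ω‖) ^ 2 ∂σ := integral_nonneg fun ω => sq_nonneg _
        have h4 : ∀ ω, (t - ‖f ω‖) ^ 2 = t ^ 2 + (-2 * t) * ‖f ω‖ + ‖f ω‖ ^ 2 := fun ω => by ring
        simp only [h4] at h3
        rw [integral_add (hint (by fun_prop)) (hint (by fun_prop)),
          integral_add (hint (by fun_prop)) (hint (by fun_prop)), integral_const_mul,
          integral_const, smul_eq_mul] at h3
        linarith
    rw [discrim] at hd
    nlinarith
  calc ‖∫ ω, f ω * p ω ∂σ‖ ^ 2 ≤ (|B| * ∫ ω, ‖f ω‖ ∂σ) ^ 2 := by gcongr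
    _ = |B| ^ 2 * (∫ ω, ‖f ω‖ ∂σ) ^ 2 := by ring
    _ ≤ |B| ^ 2 * (σ.real univ * ∫ ω, ‖f ω‖ ^ 2 ∂σ) := by gcongr
    _ = _ := by ring

end HyperbolicPolar

/-! ### Radial differential equation for the spherical coefficients. -/

section SphericalCoefficients

open MeasureTheory Set Filter

variable {n : ℕ}

theorem integral_linear_combination_three {Ω : Type*} [MeasurableSpace Ω] {σ : Measure Ω}
    {f g h : Ω → ℂ} (hf : Integrable f σ) (hg : Integrable g σ) (hh : Integrable h σ)
    (a b c : ℂ) : ∫ ω, (a * f ω + b * g ω + c * h ω) ∂σ =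
      a * ∫ ω, f ω ∂σ + b * ∫ ω, g ω ∂σ + c * ∫ ω, h ω ∂σ := by
  have hfg : Integrable (fun ω => a * f ω + b * g ω) σ := (hf.const_mul a).add (hg.const_mul b)
  rw [integral_add hfg (hh.const_mul c), integral_add (hf.const_mul a) (hg.const_mul b),
    integral_const_mul, integral_const_mul, integral_const_mul]

theorem laplacian_eq_sum_fderiv (u : EuclideanSpace ℝ (Fin n) → ℂ) (x : EuclideanSpace ℝ (Fin n)) :
    Laplacian.laplacian u x = ∑ k, fderiv ℝ (fderiv ℝ u) x (EuclideanSpace.single k 1)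
      (EuclideanSpace.single k 1) := by
  rw [InnerProductSpace.laplacian_eq_iteratedFDeriv_orthonormalBasis u
    (EuclideanSpace.basisFun (Fin n) ℝ)]
  simp [iteratedFDeriv_two_apply]

theorem fderiv_fderiv_comp_smul (u : EuclideanSpace ℝ (Fin n) → ℂ) (c : ℝ)
    (x v w : EuclideanSpace ℝ (Fin n)) :
    fderiv ℝ (fderiv ℝ fun y => u (c • y)) x v w =
      (c : ℂ) ^ 2 * fderiv ℝ (fderiv ℝ u) (c • x) v w := by
  have h : (fderiv ℝ fun y => u (c • y)) = c • fun y => fderiv ℝ u (c • y) := by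
    funext y
    exact fderiv_comp_smul c
  have h2 : fderiv ℝ (fun y => fderiv ℝ u (c • y)) x = c • fderiv ℝ (fderiv ℝ u) (c • x) :=
    fderiv_comp_smul c
  have h3 : fderiv ℝ (c • fun y => fderiv ℝ u (c • y)) x =
      c • fderiv ℝ (fun y => fderiv ℝ u (c • y)) x :=
    congrFun (fderiv_const_smul_field (𝕜 := ℝ) (f := fun y => fderiv ℝ u (c • y)) c) x
  rw [h, h3, h2]
  simp
  ring

/-- The spherical coefficient of `u` on the hyperbolic sphere of radius `s` against the polynomial
`P`. -/
noncomputable def sphCoeff (u : EuclideanSpace ℝ (Fin n) → ℂ) (P : MvPolynomial (Fin n) ℝ)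
    (s : ℝ) : ℂ :=
  ∫ ω : Metric.sphere (0 : EuclideanSpace ℝ (Fin n)) 1,
    u (Real.tanh (s / 2) • (ω : EuclideanSpace ℝ (Fin n))) * polyFun P ω
    ∂(volume : Measure (EuclideanSpace ℝ (Fin n))).toSphere

/-- The spherical coefficient of the Euclidean radial derivative of `u`. -/
noncomputable def sphCoeffDeriv (u : EuclideanSpace ℝ (Fin n) → ℂ) (P : MvPolynomial (Fin n) ℝ)
    (s : ℝ) : ℂ :=
  ∫ ω : Metric.sphere (0 : EuclideanSpace ℝ (Fin n)) 1,
    fderiv ℝ u (Real.tanh (s / 2) • (ω : EuclideanSpace ℝ (Fin n))) ω * polyFun P ω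
    ∂(volume : Measure (EuclideanSpace ℝ (Fin n))).toSphere

/-- The spherical coefficient of the second Euclidean radial derivative of `u`. -/
noncomputable def sphCoeffDerivTwo (u : EuclideanSpace ℝ (Fin n) → ℂ)
    (P : MvPolynomial (Fin n) ℝ) (s : ℝ) : ℂ :=
  ∫ ω : Metric.sphere (0 : EuclideanSpace ℝ (Fin n)) 1,
    fderiv ℝ (fderiv ℝ u) (Real.tanh (s / 2) • (ω : EuclideanSpace ℝ (Fin n))) ω ω * polyFun P ω
    ∂(volume : Measure (EuclideanSpace ℝ (Fin n))).toSphere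

variable {R₀ : ℝ} {u : EuclideanSpace ℝ (Fin n) → ℂ}

theorem continuousOn_polar (hR₀ : 0 < R₀) {F : Type*} [TopologicalSpace F]
    {g : EuclideanSpace ℝ (Fin n) → F} (hg : ContinuousOn g (poincareBall n \ hypClosedBall n R₀)) :
    ContinuousOn (fun p : ℝ × Metric.sphere (0 : EuclideanSpace ℝ (Fin n)) 1 =>
      g (Real.tanh (p.1 / 2) • (p.2 : EuclideanSpace ℝ (Fin n)))) (Ioi R₀ ×ˢ univ) := by
  have ht : Continuous fun s : ℝ => Real.tanh (s / 2) :=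
    continuous_iff_continuousAt.2 fun s => (hasDerivAt_tanh_half s).continuousAt
  have hc : Continuous fun p : ℝ × Metric.sphere (0 : EuclideanSpace ℝ (Fin n)) 1 =>
      Real.tanh (p.1 / 2) • (p.2 : EuclideanSpace ℝ (Fin n)) :=
    (ht.comp continuous_fst).smul (by fun_prop)
  exact hg.comp hc.continuousOn fun p hp => tanh_smul_mem_hypExterior hR₀ hp.1 p.2

theorem continuous_polar_slice (hR₀ : 0 < R₀) {F : Type*} [TopologicalSpace F]
    {g : EuclideanSpace ℝ (Fin n) → F} (hg : ContinuousOn g (poincareBall n \ hypClosedBall n R₀))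
    {s : ℝ} (hs : R₀ < s) :
    Continuous (fun ω : Metric.sphere (0 : EuclideanSpace ℝ (Fin n)) 1 =>
      g (Real.tanh (s / 2) • (ω : EuclideanSpace ℝ (Fin n)))) :=
  hg.comp_continuous (by fun_prop) fun ω => tanh_smul_mem_hypExterior hR₀ hs ω

theorem continuous_polyFun_sphere (P : MvPolynomial (Fin n) ℝ) :
    Continuous fun ω : Metric.sphere (0 : EuclideanSpace ℝ (Fin n)) 1 =>
      polyFun P (ω : EuclideanSpace ℝ (Fin n)) :=
  (contDiff_polyFun P).continuous.comp continuous_subtype_val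

theorem continuousOn_fderiv_hypExterior
    (hu : ContDiffOn ℝ 2 u (poincareBall n \ hypClosedBall n R₀)) :
    ContinuousOn (fderiv ℝ u) (poincareBall n \ hypClosedBall n R₀) :=
  hu.continuousOn_fderiv_of_isOpen (isOpen_hypExterior R₀) (by norm_num)

theorem continuousOn_fderiv_fderiv_hypExterior
    (hu : ContDiffOn ℝ 2 u (poincareBall n \ hypClosedBall n R₀)) :
    ContinuousOn (fderiv ℝ (fderiv ℝ u)) (poincareBall n \ hypClosedBall n R₀) :=
  (hu.fderiv_of_isOpen (isOpen_hypExterior R₀) (m := 1) (by norm_num)).continuousOn_fderiv_of_isOpen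
    (isOpen_hypExterior R₀) le_rfl

theorem hasDerivAt_tanh_half_smul (x : EuclideanSpace ℝ (Fin n)) (s : ℝ) :
    HasDerivAt (fun s : ℝ => Real.tanh (s / 2) • x) (((1 - Real.tanh (s / 2) ^ 2) / 2) • x) s :=
  (hasDerivAt_tanh_half s).smul_const x

/-- The factor is the derivative of the Euclidean radius tanh(s/2) with respect to the hyperbolic
radius s. -/
theorem hasDerivAt_sphCoeff (hR₀ : 0 < R₀)
    (hu : ContDiffOn ℝ 2 u (poincareBall n \ hypClosedBall n R₀)) (P : MvPolynomial (Fin n) ℝ)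
    {s : ℝ} (hs : R₀ < s) :
    HasDerivAt (sphCoeff u P)
      (((1 - Real.tanh (s / 2) ^ 2) / 2 : ℝ) * sphCoeffDeriv u P s) s := by
  have hfd := continuousOn_fderiv_hypExterior hu
  have hp := continuous_polyFun_sphere P
  have ht : Continuous fun s : ℝ => Real.tanh (s / 2) :=
    continuous_iff_continuousAt.2 fun s => (hasDerivAt_tanh_half s).continuousAt
  have key := hasDerivAt_integral_of_continuousOn_compact
    (volume : Measure (EuclideanSpace ℝ (Fin n))).toSphere (isOpen_Ioi (a := R₀))
    (F := fun s (ω : Metric.sphere (0 : EuclideanSpace ℝ (Fin n)) 1) =>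
      u (Real.tanh (s / 2) • (ω : EuclideanSpace ℝ (Fin n))) * polyFun P ω)
    (F' := fun s (ω : Metric.sphere (0 : EuclideanSpace ℝ (Fin n)) 1) =>
      ((1 - Real.tanh (s / 2) ^ 2) / 2 : ℝ) *
        (fderiv ℝ u (Real.tanh (s / 2) • (ω : EuclideanSpace ℝ (Fin n))) ω * polyFun P ω))
    (fun t ht => (continuous_polar_slice hR₀ hu.continuousOn ht).mul hp)
    (by
      refine ContinuousOn.mul (Continuous.continuousOn ?_) (ContinuousOn.mul ?_ ?_)
      · exact Complex.continuous_ofReal.comp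
          ((continuous_const.sub ((ht.comp continuous_fst).pow 2)).div_const 2)
      · exact (continuousOn_polar hR₀ hfd).clm_apply
          (continuous_subtype_val.comp continuous_snd).continuousOn
      · exact (hp.comp continuous_snd).continuousOn)
    (fun t ht ω => by
      have h1 := ((hu.differentiableOn two_ne_zero).differentiableAt
        ((isOpen_hypExterior R₀).mem_nhds
          (tanh_smul_mem_hypExterior hR₀ ht ω))).hasFDerivAt.comp_hasDerivAt t
          (hasDerivAt_tanh_half_smul (ω : EuclideanSpace ℝ (Fin n)) t)
      have h2 := h1.mul_const (polyFun P ω)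
      rw [map_smul, Complex.real_smul, mul_assoc] at h2
      exact h2)
    hs
  rw [integral_const_mul] at key
  exact key

theorem hasDerivAt_sphCoeffDeriv (hR₀ : 0 < R₀)
    (hu : ContDiffOn ℝ 2 u (poincareBall n \ hypClosedBall n R₀)) (P : MvPolynomial (Fin n) ℝ)
    {s : ℝ} (hs : R₀ < s) :
    HasDerivAt (sphCoeffDeriv u P)
      (((1 - Real.tanh (s / 2) ^ 2) / 2 : ℝ) * sphCoeffDerivTwo u P s) s := by
  have hfd := continuousOn_fderiv_hypExterior hu
  have hfd2 := continuousOn_fderiv_fderiv_hypExterior hu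
  have hp := continuous_polyFun_sphere P
  have ht : Continuous fun s : ℝ => Real.tanh (s / 2) :=
    continuous_iff_continuousAt.2 fun s => (hasDerivAt_tanh_half s).continuousAt
  have key := hasDerivAt_integral_of_continuousOn_compact
    (volume : Measure (EuclideanSpace ℝ (Fin n))).toSphere (isOpen_Ioi (a := R₀))
    (F := fun s (ω : Metric.sphere (0 : EuclideanSpace ℝ (Fin n)) 1) =>
      fderiv ℝ u (Real.tanh (s / 2) • (ω : EuclideanSpace ℝ (Fin n))) ω * polyFun P ω)
    (F' := fun s (ω : Metric.sphere (0 : EuclideanSpace ℝ (Fin n)) 1) =>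
      ((1 - Real.tanh (s / 2) ^ 2) / 2 : ℝ) *
        (fderiv ℝ (fderiv ℝ u) (Real.tanh (s / 2) • (ω : EuclideanSpace ℝ (Fin n))) ω ω *
          polyFun P ω))
    (fun t ht => ((continuous_polar_slice hR₀ hfd ht).clm_apply continuous_subtype_val).mul hp)
    (by
      refine ContinuousOn.mul (Continuous.continuousOn ?_) (ContinuousOn.mul ?_ ?_)
      · exact Complex.continuous_ofReal.comp
          ((continuous_const.sub ((ht.comp continuous_fst).pow 2)).div_const 2)
      · exact ((continuousOn_polar hR₀ hfd2).clm_apply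
          (continuous_subtype_val.comp continuous_snd).continuousOn).clm_apply
          (continuous_subtype_val.comp continuous_snd).continuousOn
      · exact (hp.comp continuous_snd).continuousOn)
    (fun t ht ω => by
      have h1 := (((hu.fderiv_of_isOpen (isOpen_hypExterior R₀) (m := 1)
        (by norm_num)).differentiableOn one_ne_zero).differentiableAt
        ((isOpen_hypExterior R₀).mem_nhds
          (tanh_smul_mem_hypExterior hR₀ ht ω))).hasFDerivAt.comp_hasDerivAt t
          (hasDerivAt_tanh_half_smul (ω : EuclideanSpace ℝ (Fin n)) t)
      have h2 := (h1.clm_apply (hasDerivAt_const t (ω : EuclideanSpace ℝ (Fin n)))).mul_const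
        (polyFun P ω)
      simp only [map_smul, _root_.smul_apply, Complex.real_smul, map_zero, add_zero,
        mul_assoc] at h2
      exact h2)
    hs
  rw [integral_const_mul] at key
  exact key

/-- The radial equation satisfied by the spherical coefficients of a solution of the Helmholtz
equation. -/
theorem sphCoeff_radial_equation {μ : ℝ} (hR₀ : 0 < R₀)
    (hu : ContDiffOn ℝ 2 u (poincareBall n \ hypClosedBall n R₀))
    (heq : ∀ x ∈ poincareBall n \ hypClosedBall n R₀,
      -hypLaplacian u x - (((n : ℂ) - 1) ^ 2 / 4) * u x - (μ : ℂ) ^ 2 * u x = 0)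
    {P : MvPolynomial (Fin n) ℝ} {d : ℕ} (hP : P.IsHomogeneous d) {s : ℝ} (hs : R₀ < s)
    (hlower : sphCoeff u (polyLaplacian P) s = 0) :
    (((1 - Real.tanh (s / 2) ^ 2) / 2 : ℝ) : ℂ) ^ 2 *
        ((Real.tanh (s / 2) : ℂ) ^ 2 * sphCoeffDerivTwo u P s
          + ((n : ℂ) - 1) * (Real.tanh (s / 2) : ℂ) * sphCoeffDeriv u P s
          - (d * ((d - 1 : ℕ) + ((n : ℝ) - 1)) : ℝ) * sphCoeff u P s)
      + (((1 - Real.tanh (s / 2) ^ 2) / 2 : ℝ) : ℂ) * ((n : ℂ) - 2) *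
        (Real.tanh (s / 2) : ℂ) ^ 3 * sphCoeffDeriv u P s
      + (Real.tanh (s / 2) : ℂ) ^ 2 * ((((n : ℂ) - 1) ^ 2 / 4) + (μ : ℂ) ^ 2) * sphCoeff u P s
      = 0 := by
  set τ := Real.tanh (s / 2) with hτ
  obtain ⟨h0, h1⟩ := tanh_half_mem_Ioo (hR₀.trans hs)
  have hfd := continuousOn_fderiv_hypExterior hu
  have hfd2 := continuousOn_fderiv_fderiv_hypExterior hu
  have hp := continuous_polyFun_sphere P
  have hint : ∀ {f : Metric.sphere (0 : EuclideanSpace ℝ (Fin n)) 1 → ℂ}, Continuous f →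
      Integrable f (volume : Measure (EuclideanSpace ℝ (Fin n))).toSphere := fun hf =>
    hf.integrable_of_hasCompactSupport (HasCompactSupport.of_compactSpace _)
  have hc0 := continuous_polar_slice hR₀ hu.continuousOn hs
  have hc1 := (continuous_polar_slice hR₀ hfd hs).clm_apply continuous_subtype_val
  have hc2 := ((continuous_polar_slice hR₀ hfd2 hs).clm_apply continuous_subtype_val).clm_apply
    continuous_subtype_val
  have hcL : Continuous fun ω : Metric.sphere (0 : EuclideanSpace ℝ (Fin n)) 1 =>
      ∑ k, fderiv ℝ (fderiv ℝ u) (τ • (ω : EuclideanSpace ℝ (Fin n)))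
        (EuclideanSpace.single k 1) (EuclideanSpace.single k 1) :=
    continuous_finsetSum _ fun k _ =>
      ((continuous_polar_slice hR₀ hfd2 hs).clm_apply continuous_const).clm_apply continuous_const
  have iL : Integrable (fun ω : Metric.sphere (0 : EuclideanSpace ℝ (Fin n)) 1 =>
      (∑ k, fderiv ℝ (fderiv ℝ u) (τ • (ω : EuclideanSpace ℝ (Fin n)))
        (EuclideanSpace.single k 1) (EuclideanSpace.single k 1)) * polyFun P ω)
      (volume : Measure (EuclideanSpace ℝ (Fin n))).toSphere := hint (hcL.mul hp)
  have i2 : Integrable (fun ω : Metric.sphere (0 : EuclideanSpace ℝ (Fin n)) 1 =>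
      fderiv ℝ (fderiv ℝ u) (τ • (ω : EuclideanSpace ℝ (Fin n))) ω ω * polyFun P ω)
      (volume : Measure (EuclideanSpace ℝ (Fin n))).toSphere := hint (hc2.mul hp)
  have i1 : Integrable (fun ω : Metric.sphere (0 : EuclideanSpace ℝ (Fin n)) 1 =>
      fderiv ℝ u (τ • (ω : EuclideanSpace ℝ (Fin n))) ω * polyFun P ω)
      (volume : Measure (EuclideanSpace ℝ (Fin n))).toSphere := hint (hc1.mul hp)
  have i0 : Integrable (fun ω : Metric.sphere (0 : EuclideanSpace ℝ (Fin n)) 1 =>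
      u (τ • (ω : EuclideanSpace ℝ (Fin n))) * polyFun P ω)
      (volume : Measure (EuclideanSpace ℝ (Fin n))).toSphere := hint (hc0.mul hp)
  set L : ℂ := ∫ ω : Metric.sphere (0 : EuclideanSpace ℝ (Fin n)) 1,
      (∑ k, fderiv ℝ (fderiv ℝ u) (τ • (ω : EuclideanSpace ℝ (Fin n)))
        (EuclideanSpace.single k 1) (EuclideanSpace.single k 1)) * polyFun P ω
      ∂(volume : Measure (EuclideanSpace ℝ (Fin n))).toSphere with hL
  have hU : IsOpen ((fun x : EuclideanSpace ℝ (Fin n) => τ • x) ⁻¹'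
      (poincareBall n \ hypClosedBall n R₀)) :=
    (isOpen_hypExterior R₀).preimage (by fun_prop)
  -- Rescaling by τ brings the sphere of radius τ to the unit sphere, where self-adjointness of the
  -- spherical Laplacian is available.
  have hsph := integral_toSphere_sphericalLaplacian_mul_polyFun hU
    (fun ω hω => tanh_smul_mem_hypExterior hR₀ hs ⟨ω, hω⟩)
    (v := fun x => u (τ • x))
    (hu.comp (contDiff_const_smul τ).contDiffOn fun x hx => hx) hP
  have hpt : ∀ ω : Metric.sphere (0 : EuclideanSpace ℝ (Fin n)) 1,
      (∑ k, fderiv ℝ (fderiv ℝ fun y => u (τ • y)) ω (EuclideanSpace.single k 1)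
          (EuclideanSpace.single k 1)
        - fderiv ℝ (fderiv ℝ fun y => u (τ • y)) ω ω ω
        - ((n : ℂ) - 1) * fderiv ℝ (fun y => u (τ • y)) ω ω) * polyFun P ω =
      (τ : ℂ) ^ 2 * ((∑ k, fderiv ℝ (fderiv ℝ u) (τ • (ω : EuclideanSpace ℝ (Fin n)))
        (EuclideanSpace.single k 1) (EuclideanSpace.single k 1)) * polyFun P ω)
      + -(τ : ℂ) ^ 2 * (fderiv ℝ (fderiv ℝ u) (τ • (ω : EuclideanSpace ℝ (Fin n))) ω ω *
        polyFun P ω)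
      + -(((n : ℂ) - 1) * τ) * (fderiv ℝ u (τ • (ω : EuclideanSpace ℝ (Fin n))) ω *
        polyFun P ω) := by
    intro ω
    simp only [fderiv_fderiv_comp_smul, fderiv_comp_smul, _root_.smul_apply, Complex.real_smul,
      ← Finset.mul_sum]
    ring
  simp only [hpt] at hsph
  rw [integral_linear_combination_three iL i2 i1] at hsph
  have hsph' : (τ : ℂ) ^ 2 * L + -(τ : ℂ) ^ 2 * sphCoeffDerivTwo u P s
      + -(((n : ℂ) - 1) * τ) * sphCoeffDeriv u P s =
      sphCoeff u (polyLaplacian P) s -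
        (d * ((d - 1 : ℕ) + ((n : ℝ) - 1)) : ℝ) * sphCoeff u P s := hsph
  have hpde : ∀ ω : Metric.sphere (0 : EuclideanSpace ℝ (Fin n)) 1,
      (((1 - τ ^ 2) / 2 : ℝ) : ℂ) ^ 2 *
        ((∑ k, fderiv ℝ (fderiv ℝ u) (τ • (ω : EuclideanSpace ℝ (Fin n)))
        (EuclideanSpace.single k 1) (EuclideanSpace.single k 1)) * polyFun P ω)
      + ((((1 - τ ^ 2) / 2 : ℝ) : ℂ) * ((n : ℂ) - 2) * τ) *
        (fderiv ℝ u (τ • (ω : EuclideanSpace ℝ (Fin n))) ω * polyFun P ω)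
      + ((((n : ℂ) - 1) ^ 2 / 4) + (μ : ℂ) ^ 2) *
        (u (τ • (ω : EuclideanSpace ℝ (Fin n))) * polyFun P ω) = 0 := by
    intro ω
    have h := heq _ (tanh_smul_mem_hypExterior hR₀ hs ω)
    have hn : ‖τ • (ω : EuclideanSpace ℝ (Fin n))‖ = τ := by
      rw [norm_smul, norm_eq_of_mem_sphere, mul_one, Real.norm_eq_abs, abs_of_pos h0]
    have hgrad : ∑ i, (τ • (ω : EuclideanSpace ℝ (Fin n))) i •
        fderiv ℝ u (τ • (ω : EuclideanSpace ℝ (Fin n))) (EuclideanSpace.single i (1 : ℝ)) =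
        τ * fderiv ℝ u (τ • (ω : EuclideanSpace ℝ (Fin n))) ω := by
      simp only [← map_smul, ← map_sum]
      rw [euclidean_sum_coord_smul_single, map_smul, Complex.real_smul]
    rw [hypLaplacian, laplacian_eq_sum_fderiv, ← hτ, hn, hgrad] at h
    simp only [Complex.real_smul] at h
    push_cast at h ⊢
    linear_combination (-polyFun P ω) * h
  have hpdeI := integral_congr_ae (μ := (volume : Measure (EuclideanSpace ℝ (Fin n))).toSphere)
    (.of_forall hpde)
  simp only [integral_zero] at hpdeI
  rw [integral_linear_combination_three iL i1 i0] at hpdeI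
  have hpdeI' : (((1 - τ ^ 2) / 2 : ℝ) : ℂ) ^ 2 * L
      + ((((1 - τ ^ 2) / 2 : ℝ) : ℂ) * ((n : ℂ) - 2) * τ) * sphCoeffDeriv u P s
      + ((((n : ℂ) - 1) ^ 2 / 4) + (μ : ℂ) ^ 2) * sphCoeff u P s = 0 := hpdeI
  rw [hlower] at hsph'
  -- The integrated Laplacian L occurs in both the integrated equation and the spherical identity;
  -- this combination eliminates it.
  linear_combination (τ : ℂ) ^ 2 * hpdeI' - (((1 - τ ^ 2) / 2 : ℝ) : ℂ) ^ 2 * hsph'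

end SphericalCoefficients

/-! ### Reduction to the decaying ODE and the Rellich theorem. -/

section Rellich

open MeasureTheory Set Filter

variable {n : ℕ} {R₀ μ : ℝ} {u : EuclideanSpace ℝ (Fin n) → ℂ}

/-- The true decay rate is e^(-2s), but the ODE argument only needs e^(-s). -/
theorem inv_sinh_sq_le {s : ℝ} (hs : 1 ≤ s) : (Real.sinh s ^ 2)⁻¹ ≤ 16 * Real.exp (-s) := by
  have h1 : 2 ≤ Real.exp s := by linarith [Real.add_one_le_exp s]
  have hpos := Real.exp_pos s
  have h2 : Real.exp (-s) = (Real.exp s)⁻¹ := Real.exp_neg s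
  have h3 : Real.exp (-s) ≤ 1 / 2 := by
    rw [h2, ← one_div]
    exact one_div_le_one_div_of_le two_pos h1
  have h4 : Real.exp s / 4 ≤ Real.sinh s := by
    rw [Real.sinh_eq]
    linarith
  have h5 : Real.exp s / 16 ≤ Real.sinh s ^ 2 := by nlinarith
  calc (Real.sinh s ^ 2)⁻¹ ≤ (Real.exp s / 16)⁻¹ := inv_anti₀ (by positivity) h5
    _ = 16 * Real.exp (-s) := by rw [h2, inv_div]; rfl

/-- The weight `(sinh s)^{(n-1)/2}`. -/
noncomputable def sinhWeight (n : ℕ) (s : ℝ) : ℝ :=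
  Real.exp (((n : ℝ) - 1) / 2 * Real.log (Real.sinh s))

/-- The right side is the density in `integral_hypSphereMeasure`, which is why this weight converts
the hypothesis on u into decay of the coefficients. The assumption on n keeps `n - 1` from
truncating. -/
theorem sinhWeight_sq (hn : 1 ≤ n) {s : ℝ} (hs : 0 < s) :
    sinhWeight n s ^ 2 = Real.sinh s ^ (n - 1) := by
  have h := Real.sinh_pos_iff.2 hs
  rw [sinhWeight, ← Real.exp_nat_mul, ← Real.exp_log (pow_pos h (n - 1)), Real.log_pow]
  congr 1
  push_cast [Nat.cast_sub hn]
  ring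

theorem hasDerivAt_sinhWeight {s : ℝ} (hs : 0 < s) :
    HasDerivAt (fun s => (sinhWeight n s : ℂ))
      ((sinhWeight n s : ℂ) *
        ((((n : ℝ) - 1) / 2 * (Real.cosh s / Real.sinh s) : ℝ) : ℂ)) s := by
  have h := Real.sinh_pos_iff.2 hs
  have := ((((Real.hasDerivAt_sinh s).log h.ne').const_mul (((n : ℝ) - 1) / 2)).exp).ofReal_comp
  rw [Complex.ofReal_mul] at this
  exact this

theorem hasDerivAt_cosh_div_sinh {s : ℝ} (hs : 0 < s) :
    HasDerivAt (fun s => Real.cosh s / Real.sinh s) (-(Real.sinh s ^ 2)⁻¹) s := by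
  have h := Real.sinh_pos_iff.2 hs
  convert! (Real.hasDerivAt_cosh s).div (Real.hasDerivAt_sinh s) h.ne' using 1
  field_simp
  linarith [Real.cosh_sq s]

/-- The spherical coefficients of a solution, suitably weighted, tend to zero at infinity. -/
theorem tendsto_sinhWeight_mul_sphCoeff (hn : 1 ≤ n) (hR₀ : 0 < R₀)
    (hu : ContDiffOn ℝ 2 u (poincareBall n \ hypClosedBall n R₀))
    (hlim : Tendsto (fun R : ℝ => ∫ x, ‖u x‖ ^ 2 ∂(hypSphereMeasure n R)) atTop (𝓝 0))
    (P : MvPolynomial (Fin n) ℝ) :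
    Tendsto (fun s => (sinhWeight n s : ℂ) * sphCoeff u P s) atTop (𝓝 0) := by
  obtain ⟨C, hC0, hC⟩ := sq_norm_integral_mul_le
    (volume : Measure (EuclideanSpace ℝ (Fin n))).toSphere (continuous_polyFun_sphere P)
  have hsq : Tendsto (fun s => ‖(sinhWeight n s : ℂ) * sphCoeff u P s‖ ^ 2) atTop (𝓝 0) := by
    refine squeeze_zero' (.of_forall fun s => by positivity) ?_
      (by simpa using hlim.const_mul C)
    filter_upwards [eventually_gt_atTop R₀] with s hs
    have hs0 := hR₀.trans hs
    have hsinh := Real.sinh_pos_iff.2 hs0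
    rw [integral_hypSphereMeasure hs0 (fun x => ‖u x‖ ^ 2), norm_mul, mul_pow, Complex.norm_real,
      Real.norm_eq_abs, sq_abs, sinhWeight_sq hn hs0, mul_left_comm]
    exact mul_le_mul_of_nonneg_left (hC _ (continuous_polar_slice hR₀ hu.continuousOn hs))
      (by positivity)
  rw [tendsto_zero_iff_norm_tendsto_zero]
  have := hsq.sqrt
  simpa only [Real.sqrt_sq (norm_nonneg _), Real.sqrt_zero] using this

/-- All the spherical coefficients of a solution satisfying the Rellich condition vanish. -/
theorem sphCoeff_eq_zero (hn : 1 ≤ n) (hR₀ : 0 < R₀)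
    (hu : ContDiffOn ℝ 2 u (poincareBall n \ hypClosedBall n R₀))
    (heq : ∀ x ∈ poincareBall n \ hypClosedBall n R₀,
      -hypLaplacian u x - (((n : ℂ) - 1) ^ 2 / 4) * u x - (μ : ℂ) ^ 2 * u x = 0)
    (hlim : Tendsto (fun R : ℝ => ∫ x, ‖u x‖ ^ 2 ∂(hypSphereMeasure n R)) atTop (𝓝 0))
    {P : MvPolynomial (Fin n) ℝ} {d : ℕ} (hP : P.IsHomogeneous d) {s : ℝ} (hs : R₀ < s) :
    sphCoeff u P s = 0 := by
  induction d using Nat.strong_induction_on generalizing P s with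
  | _ d ih =>
  -- P is not assumed harmonic; the extra term from its Laplacian has lower degree and vanishes by
  -- induction.
  have hlower : ∀ t, R₀ < t → sphCoeff u (polyLaplacian P) t = 0 := by
    intro t ht
    rcases Nat.eq_zero_or_pos d with rfl | hd
    · rw [hP.polyLaplacian_of_zero]
      simp [sphCoeff, polyFun]
    · exact ih (d - 1 - 1) (by omega) hP.polyLaplacian ht
  set m : ℝ := ((n : ℝ) - 1) / 2 with hm
  set l : ℝ := d * ((d - 1 : ℕ) + ((n : ℝ) - 1)) with hl
  let τ : ℝ → ℝ := fun t => Real.tanh (t / 2)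
  let k : ℝ → ℝ := fun t => Real.cosh t / Real.sinh t
  let w : ℝ → ℂ := fun t => (sinhWeight n t : ℂ) * sphCoeff u P t
  let w' : ℝ → ℂ := fun t => (sinhWeight n t : ℂ) *
    ((m * k t : ℝ) * sphCoeff u P t + ((1 - τ t ^ 2) / 2 : ℝ) * sphCoeffDeriv u P t)
  have hw : ∀ t, R₀ < t → HasDerivAt w (w' t) t := by
    intro t ht
    refine ((hasDerivAt_sinhWeight (n := n) (hR₀.trans ht)).mul
      (hasDerivAt_sphCoeff hR₀ hu P ht)).congr_deriv ?_
    simp only [w', τ, k, hm]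
    ring
  -- With m = (n-1)/2, the weight S = (sinh t)^m satisfies S''/S = m² + (m² - m)/sinh². The m²
  -- cancels against the spectral shift, and l/sinh² is the spherical contribution.
  have hw' : ∀ t, R₀ < t → HasDerivAt w'
      ((((m ^ 2 - m + l) * (Real.sinh t ^ 2)⁻¹ : ℝ) - (μ : ℂ) ^ 2) * w t) t := by
    intro t ht
    have ht0 := hR₀.trans ht
    obtain ⟨h0, h1⟩ := tanh_half_mem_Ioo ht0
    have hmk : HasDerivAt (fun t => ((m * k t : ℝ) : ℂ))
        ((m * -(Real.sinh t ^ 2)⁻¹ : ℝ) : ℂ) t :=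
      ((hasDerivAt_cosh_div_sinh ht0).const_mul m).ofReal_comp
    have hτ2 : HasDerivAt (fun t => (((1 - τ t ^ 2) / 2 : ℝ) : ℂ))
        ((-(τ t * ((1 - τ t ^ 2) / 2)) : ℝ) : ℂ) t := by
      refine HasDerivAt.ofReal_comp ?_
      refine ((((hasDerivAt_tanh_half t).pow 2).const_sub 1).div_const 2).congr_deriv ?_
      simp only [τ]
      ring
    have hmain := (hasDerivAt_sinhWeight (n := n) ht0).mul
      ((hmk.mul (hasDerivAt_sphCoeff hR₀ hu P ht)).add
        (hτ2.mul (hasDerivAt_sphCoeffDeriv hR₀ hu P ht)))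
    refine hmain.congr_deriv ?_
    have hrad := sphCoeff_radial_equation hR₀ hu heq hP ht (hlower t ht)
    simp only [Pi.add_apply, Pi.mul_apply, w, τ, k]
    rw [← hl] at hrad
    -- Writing sinh and cosh rationally in r = tanh(t/2) makes the claim an algebraic multiple of
    -- the radial equation.
    have hsinh := sinh_eq_tanh_half t
    have hcosh := cosh_eq_tanh_half t
    rw [hsinh, hcosh]
    set r := Real.tanh (t / 2) with hr
    have hr1 : (1 : ℝ) - r ^ 2 ≠ 0 := by nlinarith
    have hr0 : r ≠ 0 := h0.ne'
    have hr1' : (1 : ℂ) - (r : ℂ) ^ 2 ≠ 0 := by exact_mod_cast hr1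
    have hr0' : (r : ℂ) ≠ 0 := by exact_mod_cast hr0
    have hm' : (n : ℂ) = 2 * (m : ℂ) + 1 := by
      rw [hm]; push_cast; ring
    have hnm : (n : ℝ) - 1 = 2 * m := by rw [hm]; ring
    rw [hm'] at hrad
    rw [hnm]
    generalize sphCoeff u P t = b at *
    generalize sphCoeffDeriv u P t = a₁ at *
    generalize sphCoeffDerivTwo u P t = a₂ at *
    generalize (sinhWeight n t : ℂ) = S at *
    clear_value l m r
    push_cast at hrad ⊢
    field_simp at hrad ⊢
    linear_combination (S / 4) * hrad
  have hqc : ContinuousOn (fun t => (m ^ 2 - m + l) * (Real.sinh t ^ 2)⁻¹) (Ioi R₀) := by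
    refine continuousOn_const.mul (ContinuousOn.inv₀ (by fun_prop) fun t ht => ?_)
    exact pow_ne_zero 2 (Real.sinh_pos_iff.2 (hR₀.trans ht)).ne'
  have hq : ∀ᶠ t in atTop, |(m ^ 2 - m + l) * (Real.sinh t ^ 2)⁻¹| ≤
      (|m ^ 2 - m + l| * 16) * Real.exp (-t) := by
    filter_upwards [eventually_ge_atTop 1] with t ht
    rw [abs_mul, mul_assoc, abs_of_nonneg (by positivity : (0 : ℝ) ≤ (Real.sinh t ^ 2)⁻¹)]
    exact mul_le_mul_of_nonneg_left (inv_sinh_sq_le ht) (abs_nonneg _)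
  have hzero : w s = 0 := eq_zero_of_ode_of_tendsto_zero hw hw' hqc hq
    (tendsto_sinhWeight_mul_sphCoeff hn hR₀ hu hlim P) hs
  exact (mul_eq_zero.1 hzero).resolve_left
    (Complex.ofReal_ne_zero.2 (Real.exp_pos _).ne')

end Rellich

theorem theorem3p3 (n : ℕ) (hn : 1 ≤ n) (μ R₀ : ℝ) (hR₀ : 0 < R₀)
    (u : EuclideanSpace ℝ (Fin n) → ℂ)
    (hu : ContDiffOn ℝ 2 u (poincareBall n \ hypClosedBall n R₀))
    (heq : ∀ x ∈ poincareBall n \ hypClosedBall n R₀,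
      -hypLaplacian u x - (((n : ℂ) - 1) ^ 2 / 4) * u x - (μ : ℂ) ^ 2 * u x = 0)
    (hlim : Filter.Tendsto (fun R : ℝ => ∫ x, ‖u x‖ ^ 2 ∂(hypSphereMeasure n R))
      Filter.atTop (𝓝 0)) :
    (∀ x ∈ poincareBall n \ hypClosedBall n R₀, u x = 0) ∧
      (ContinuousOn u (poincareBall n \ hypBall n R₀) →
        ∀ x ∈ poincareBall n \ hypBall n R₀, u x = 0) := by
  have hsphere : ∀ s, R₀ < s → ∀ ω : Metric.sphere (0 : EuclideanSpace ℝ (Fin n)) 1,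
      u (Real.tanh (s / 2) • (ω : EuclideanSpace ℝ (Fin n))) = 0 := by
    intro s hs ω
    exact congrFun (eq_zero_of_integral_toSphere_mul_polyFun
      (continuous_polar_slice hR₀ hu.continuousOn hs)
      fun d P hP => sphCoeff_eq_zero hn hR₀ hu heq hlim hP hs) ω
  have hext : ∀ x ∈ poincareBall n \ hypClosedBall n R₀, u x = 0 := by
    intro x hx
    have hx1 : ‖x‖ < 1 := hx.1
    have hρ : R₀ < hypRho x := not_le.1 fun h => hx.2 ⟨hx.1, h⟩
    have ht := tanh_half_hypRho hx1
    have hx0 : 0 < ‖x‖ := ht ▸ (tanh_half_mem_Ioo (hR₀.trans hρ)).1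
    have h := hsphere _ hρ ⟨‖x‖⁻¹ • x, by simp [norm_smul, hx0.ne']⟩
    rwa [ht, smul_inv_smul₀ hx0.ne'] at h
  refine ⟨hext, fun hc x hx => ?_⟩
  have hx1 : ‖x‖ < 1 := hx.1
  have hρ : R₀ ≤ hypRho x := not_lt.1 fun h => hx.2 ⟨hx.1, h⟩
  have hρ0 := hR₀.trans_le hρ
  have ht := tanh_half_hypRho hx1
  have hx0 : 0 < ‖x‖ := ht ▸ (tanh_half_mem_Ioo hρ0).1
  let ω : Metric.sphere (0 : EuclideanSpace ℝ (Fin n)) 1 :=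
    ⟨‖x‖⁻¹ • x, by simp [norm_smul, hx0.ne']⟩
  have hxω : Real.tanh (hypRho x / 2) • (ω : EuclideanSpace ℝ (Fin n)) = x := by
    rw [ht]
    exact smul_inv_smul₀ hx0.ne' x
  have hsub : poincareBall n \ hypClosedBall n R₀ ⊆ poincareBall n \ hypBall n R₀ :=
    fun y hy => ⟨hy.1, fun h => hy.2 ⟨h.1, h.2.le⟩⟩
  -- Points on the boundary sphere are approached along the ray through x from strictly larger
  -- hyperbolic radii, where u is already known to vanish.
  have hcurve : Filter.Tendsto
      (fun s : ℝ => Real.tanh (s / 2) • (ω : EuclideanSpace ℝ (Fin n)))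
      (𝓝[>] (hypRho x)) (𝓝[poincareBall n \ hypBall n R₀] x) := by
    refine tendsto_nhdsWithin_iff.2 ⟨?_, ?_⟩
    · have h := (hasDerivAt_tanh_half_smul (ω : EuclideanSpace ℝ (Fin n))
        (hypRho x)).continuousAt.tendsto
      rw [hxω] at h
      exact h.mono_left nhdsWithin_le_nhds
    · filter_upwards [self_mem_nhdsWithin] with s hs
      exact hsub (tanh_smul_mem_hypExterior hR₀ (hρ.trans_lt hs) ω)
  have hzero : Filter.Tendsto
      (fun s : ℝ => u (Real.tanh (s / 2) • (ω : EuclideanSpace ℝ (Fin n))))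
      (𝓝[>] (hypRho x)) (𝓝 0) := by
    refine tendsto_const_nhds.congr' ?_
    filter_upwards [self_mem_nhdsWithin] with s hs
    exact (hsphere s (hρ.trans_lt hs) ω).symm
  exact tendsto_nhds_unique ((hc x hx).tendsto.comp hcurve) hzero
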